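/- Let $n\ge 2$, let $L\subset\mathbb{R}^n$ be a full-rank lattice and let $\kappa\in(0,1]$. For $\lambda\ge 1$ and $\delta>0$ let $A_{\lambda,\delta}=\{x\in\mathbb{R}^n:\ ||x|-\lambda|<\delta\}$. Fix constants $A,K\ge 1$, $m\in\mathbb{N}$, $b>0$. A *cap* is a closed box in $\mathbb{R}^n$, of arbitrary center and orientation, with $n-1$ sides of lengths in $[A^{-1}(\lambda\delta)^{1/2},A(\lambda\delta)^{1/2}]$ and one side of length in $[A^{-1}\delta,A\delta]$. For a cap $\omega$ put $\#\omega=\#(\omega\cap 2\pi L)$ and let $d_\omega$ be the dimension of the real affine span of $\omega\cap 2\pi L$. For $\eta>0$ the cap $\omega$ is *bad* if $\#\omega\ge b(\lambda\delta)^{\frac{n-1}{2}-\eta}$. A *cap cover* of $A_{\lambda,\delta}$ is a collection $\Omega$ of caps with $A_{\lambda,\delta}\subset\bigcup_{\omega\in\Omega}\omega$, with $\omega\subset A_{\lambda,K\delta}$ for every $\omega\in\Omega$, and such that every point of $\mathbb{R}^n$ lies in at most $m$ caps of $\Omega$. Let $C_{\rm bad}(\Omega)$ be the set of bad caps in $\Omega$.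 1. For every $\sigma>0$ there is $\eta_0>0$, depending only on $n,L,\kappa,\sigma$, and there are constants $\lambda_0\ge1$ and $C>0$, depending only on $n,L,\kappa,\sigma,A,K,m,b$, such that for all $0<\eta<\eta_0$, all $\lambda\ge 1$ and all $\delta$ with $\lambda^{-1+\kappa}<\delta\le\lambda^{-\sigma}$: (a) if $\lambda\ge\lambda_0$, then every bad cap $\omega$ satisfies $d_\omega=n-1$; (b) every cap cover $\Omega$ of $A_{\lambda,\delta}$ satisfies $\#C_{\rm bad}(\Omega)\le C(\lambda\delta)^{\eta n}$ (in particular $C_{\rm bad}(\Omega)$ is finite). 2. There is a constant $C>0$, depending only on $n,L,\kappa,A,K,m,b$, such that for all $\eta>0$, all $\lambda\ge1$, all $\delta$ with $\lambda^{-1+\kappa}<\delta\le 1$, and every cap cover $\Omega$ of $A_{\lambda,\delta}$: if $d_\omega=n-1$ for every $\omega\in C_{\rm bad}(\Omega)$, then $\#C_{\rm bad}(\Omega)\le C(\lambda\delta)^{\eta n}$ (in particular $C_{\rm bad}(\Omega)$ is finite). -/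

import Mathlib

open scoped Real

namespace TorusCaps

/-- The open annulus (spherical shell) of radius `lam` and width `2 * δ` in `ℝⁿ`. -/
def annulus (n : ℕ) (lam δ : ℝ) : Set (EuclideanSpace ℝ (Fin n)) :=
  {x | |‖x‖ - lam| < δ}

/-- The closed box with center `p`, axes along the orthonormal basis `e` and side lengths `r`. -/
def box {n : ℕ} (p : EuclideanSpace ℝ (Fin n))
    (e : OrthonormalBasis (Fin n) ℝ (EuclideanSpace ℝ (Fin n))) (r : Fin n → ℝ) :
    Set (EuclideanSpace ℝ (Fin n)) :=
  {x | ∀ i, |inner ℝ (e i) (x - p)| ≤ r i / 2}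

/-- A cap: a box of arbitrary center and orientation with one short side of length comparable to
`δ` and all other sides of length comparable to `(lam * δ) ^ (1 / 2)`; comparable means up to
factors in `[A⁻¹, A]`. The orthonormal basis is arbitrary, so the label `j` of the short side
carries no information. -/
def IsCap (n : ℕ) (A lam δ : ℝ) (ω : Set (EuclideanSpace ℝ (Fin n))) : Prop :=
  ∃ (p : EuclideanSpace ℝ (Fin n))
    (e : OrthonormalBasis (Fin n) ℝ (EuclideanSpace ℝ (Fin n)))
    (r : Fin n → ℝ) (j : Fin n),
    (∀ i, i ≠ j → A⁻¹ * (lam * δ) ^ (1 / 2 : ℝ) ≤ r i ∧ r i ≤ A * (lam * δ) ^ (1 / 2 : ℝ)) ∧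
    (A⁻¹ * δ ≤ r j ∧ r j ≤ A * δ) ∧
    ω = box p e r

/-- The points of the rescaled lattice `2πL` lying in `ω`. -/
def latticePoints {n : ℕ} (L : Submodule ℤ (EuclideanSpace ℝ (Fin n)))
    (ω : Set (EuclideanSpace ℝ (Fin n))) : Set (EuclideanSpace ℝ (Fin n)) :=
  ω ∩ (fun v => (2 * π) • v) '' (L : Set (EuclideanSpace ℝ (Fin n)))

/-- The dimension `d_ω` of the real affine span of the points of `2πL` in `ω`. -/
noncomputable def latticeDim {n : ℕ} (L : Submodule ℤ (EuclideanSpace ℝ (Fin n)))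
    (ω : Set (EuclideanSpace ℝ (Fin n))) : ℕ :=
  Module.finrank ℝ (vectorSpan ℝ (latticePoints L ω))

/-- `ω` is bad (with threshold constant `b` and exponent loss `η`): it contains at least
`b * (lam * δ) ^ ((n - 1) / 2 - η)` points of `2πL`. -/
def IsBad {n : ℕ} (L : Submodule ℤ (EuclideanSpace ℝ (Fin n))) (b η lam δ : ℝ)
    (ω : Set (EuclideanSpace ℝ (Fin n))) : Prop :=
  b * (lam * δ) ^ (((n : ℝ) - 1) / 2 - η) ≤ ((latticePoints L ω).ncard : ℝ)

/-- A cover of the annulus by finitely overlapping caps that are adapted to the annulus: each of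
them lies in the annulus of the same radius and of comparable width, and no point lies in more
than `m` of them. -/
structure IsCapCover (n : ℕ) (A K : ℝ) (m : ℕ) (lam δ : ℝ)
    (Ω : Set (Set (EuclideanSpace ℝ (Fin n)))) : Prop where
  isCap : ∀ ω ∈ Ω, IsCap n A lam δ ω
  subset_annulus : ∀ ω ∈ Ω, ω ⊆ annulus n lam (K * δ)
  covers : annulus n lam δ ⊆ ⋃₀ Ω
  overlap : ∀ x, {ω ∈ Ω | x ∈ ω}.encard ≤ m

/-- The bad caps of a collection. -/
def badCaps {n : ℕ} (L : Submodule ℤ (EuclideanSpace ℝ (Fin n))) (b η lam δ : ℝ)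
    (Ω : Set (Set (EuclideanSpace ℝ (Fin n)))) : Set (Set (EuclideanSpace ℝ (Fin n))) :=
  {ω ∈ Ω | IsBad L b η lam δ ω}

end TorusCaps

/-!
The lattice points of a cap are studied through bases consisting of differences of such points.
Among finitely many vectors a basis of maximal determinant gives coordinates in `[-1, 1]` to all the
others, so that a set of lattice points with differences `u₁, …, uₙ` of this kind injects into
`Λ / ⟨u₁, …, uₙ⟩ × {-1, 0, 1}ⁿ` and has at most `3 ^ n * |det u|` elements
(`card_le_three_pow_mul_abs_det`). Put `R = (lam * δ) ^ (1 / 2)` and `X = (lam * δ) ^ η`, so that a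
bad cap has `≳ R ^ (n - 1) / X` lattice points.

If the lattice points of a cap span the whole space, their number is `≲ R ^ (n - 1) * δ`; if they
span a space of dimension at most `n - 2`, it is `≲ R ^ (n - 2)` by packing. Both contradict badness
when `δ ≤ lam ^ (-σ)`, `η` is small and `lam` is large (`exists_latticeDim_eq`).

If they span a hyperplane, completing a basis of differences by a suitable lattice vector yields a
dual lattice vector `ξ` normal to the hyperplane, all of whose coordinates in the axes of the cap are
small (`exists_dual_vector`): it is `≲ X` along the short axis and `≲ X * R / lam` along the long
ones. The center of a cap in the annulus is almost parallel to the short axis, so the cap lies in a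
cone about `ξ` of opening `≲ R * X / (lam * ‖ξ‖)` (`box_subset_doubleCone`). Comparing volumes, there
are `≲ (X / ‖ξ‖) ^ (n - 1)` caps with the same `ξ` (`ncard_caps_in_doubleCone`), and summing over the
dual vectors with `‖ξ‖ ≲ X` gives `≲ X ^ n = (lam * δ) ^ (η * n)`
(`exists_ncard_le_of_dual_vector`).
-/

open scoped Real

namespace TorusCaps

open Module

/-! ### Counting lattice points by determinants -/

/-- A finite set contains a basis of its linear span with respect to which all its elements have
coordinates in `[-1, 1]`: by Cramer's rule a family of maximal determinant will do. -/
theorem exists_linearIndependent_abs_coord_le_one {V : Type*} [AddCommGroup V] [Module ℝ V]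
    {E : Set V} (hE : E.Finite) :
    ∃ u : Fin (finrank ℝ (Submodule.span ℝ E)) → V, (∀ i, u i ∈ E) ∧ LinearIndependent ℝ u ∧
      ∀ x ∈ E, ∃ c : Fin (finrank ℝ (Submodule.span ℝ E)) → ℝ,
        (∀ i, |c i| ≤ 1) ∧ x = ∑ i, c i • u i := by
  classical
  have := hE.to_subtype
  have : FiniteDimensional ℝ (Submodule.span ℝ E) := FiniteDimensional.span_of_finite ℝ hE
  have hex := Submodule.exists_fun_fin_finrank_span_eq ℝ E
  set k := finrank ℝ (Submodule.span ℝ E) with hk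
  obtain ⟨f, hfE, -, hfli⟩ := hex
  let b : Basis (Fin k) ℝ (Submodule.span ℝ E) := finBasis ℝ _
  let incl : E → Submodule.span ℝ E := fun x => ⟨x, Submodule.subset_span x.2⟩
  let F : Fin k → E := fun i => ⟨f i, hfE i⟩
  have : Nonempty (Fin k → E) := ⟨F⟩
  obtain ⟨v, hv⟩ := Finite.exists_max (fun v : Fin k → E => |b.det (incl ∘ v)|)
  have li_of_det : ∀ w : Fin k → Submodule.span ℝ E, b.det w ≠ 0 ↔ LinearIndependent ℝ w := by
    intro w
    constructor
    · intro h
      exact (b.is_basis_iff_det.mpr (isUnit_iff_ne_zero.mpr h)).1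
    · intro h
      refine (b.is_basis_iff_det.mp ⟨h, ?_⟩).ne_zero
      exact h.span_eq_top_of_card_eq_finrank' (by simp [hk])
  have hF : b.det (incl ∘ F) ≠ 0 := by
    rw [li_of_det]
    exact LinearIndependent.of_comp (Submodule.span ℝ E).subtype hfli
  have hv0 : b.det (incl ∘ v) ≠ 0 := by
    have := hv F
    have h2 := abs_pos.mpr hF
    exact abs_pos.mp (h2.trans_le this)
  have hli := (li_of_det _).mp hv0
  have hsp : ⊤ ≤ Submodule.span ℝ (Set.range (incl ∘ v)) :=
    (hli.span_eq_top_of_card_eq_finrank' (by simp [hk])).ge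
  refine ⟨fun i => v i, fun i => (v i).2,
    hli.map' (Submodule.span ℝ E).subtype (Submodule.ker_subtype _), fun x hx => ?_⟩
  refine ⟨fun i => (Basis.mk hli hsp).repr (incl ⟨x, hx⟩) i, fun i => ?_, ?_⟩
  · have h1 := congrArg (fun g => g (incl ⟨x, hx⟩)) (b.det_smul_mk_coord_eq_det_update hli hsp i)
    simp only [LinearMap.smul_apply, MultilinearMap.toLinearMap_apply, smul_eq_mul,
      Basis.coord_apply] at h1
    have h2 := hv (Function.update v i ⟨x, hx⟩)
    simp only [Function.comp_update] at h2
    have h3 : |b.det (incl ∘ v)| * |(Basis.mk hli hsp).repr (incl ⟨x, hx⟩) i| ≤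
        |b.det (incl ∘ v)| * 1 := by
      rw [← abs_mul, h1, mul_one]; exact h2
    exact le_of_mul_le_mul_left h3 (abs_pos.mpr hv0)
  · have := congrArg (Submodule.subtype _) ((Basis.mk hli hsp).sum_repr (incl ⟨x, hx⟩))
    rw [map_sum] at this
    simpa [incl] using this.symm

theorem cast_det_restrictScalars {ι V : Type*} [Fintype ι] [DecidableEq ι] [AddCommGroup V]
    [Module ℝ V] (b : Basis ι ℝ V) (u : ι → Submodule.span ℤ (Set.range b)) :
    (((b.restrictScalars ℤ).det u : ℤ) : ℝ) = b.det (fun i => (u i : V)) := by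
  rw [Basis.det_apply, Basis.det_apply, Int.cast_det]
  congr 1
  ext i j
  exact b.restrictScalars_repr_apply ℤ (u j) i

/-- The index of a sublattice of full rank is the determinant of a basis, so that a set of lattice
points with coordinates in `[-1, 1]` is at most `3 ^ d` times as large as this determinant. -/
theorem card_le_three_pow_mul_abs_det {ι V : Type*} [Fintype ι] [DecidableEq ι] [AddCommGroup V]
    [Module ℝ V] (b : Basis ι ℝ V) {u : ι → V}
    (hu : ∀ i, u i ∈ Submodule.span ℤ (Set.range b)) (hli : LinearIndependent ℝ u)
    (T : Finset V) (hT : ∀ x ∈ T, x ∈ Submodule.span ℤ (Set.range b))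
    (hc : ∀ x ∈ T, ∃ c : ι → ℝ, (∀ i, |c i| ≤ 1) ∧ x = ∑ i, c i • u i) :
    (T.card : ℝ) ≤ 3 ^ Fintype.card ι * |b.det u| := by
  classical
  set Λ := Submodule.span ℤ (Set.range b)
  let bZ : Basis ι ℤ Λ := b.restrictScalars ℤ
  let u' : ι → Λ := fun i => ⟨u i, hu i⟩
  have hli' : LinearIndependent ℤ u' := by
    have h1 : LinearIndependent ℤ u := hli.restrict_scalars' ℤ
    exact LinearIndependent.of_comp Λ.subtype h1
  let N := Submodule.span ℤ (Set.range u')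
  have hdet : ((bZ.det u' : ℤ) : ℝ) = b.det u := cast_det_restrictScalars b u'
  have hindex : (bZ.det u').natAbs = Nat.card (Λ ⧸ N) := by
    have : Module.Free ℤ Λ := Module.Free.of_basis bZ
    have : Module.Finite ℤ Λ := Module.Finite.of_basis bZ
    have h := Submodule.natAbs_det_basis_change bZ N (Basis.span hli')
    rw [← h]
    congr 2
    funext i
    exact (Basis.coe_span_apply hli' i).symm
  have : FiniteDimensional ℝ V := Module.Finite.of_basis b
  have hdet0 : b.det u ≠ 0 := by
    have hsp := hli.span_eq_top_of_card_eq_finrank' (finrank_eq_card_basis b).symm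
    exact (b.is_basis_iff_det.mp ⟨hli, hsp⟩).ne_zero
  have hcard0 : Nat.card (Λ ⧸ N) ≠ 0 := by
    rw [← hindex]
    intro h
    rw [Int.natAbs_eq_zero] at h
    rw [h] at hdet
    exact hdet0 (by simpa using hdet.symm)
  have : Finite (Λ ⧸ N) := Nat.finite_of_card_ne_zero hcard0
  choose! c hc1 hc2 using hc
  -- A point is determined by its class and the integral parts of its coordinates.
  let φ : T → (Λ ⧸ N) × (ι → Finset.Icc (-1 : ℤ) 1) := fun x =>
    (Submodule.Quotient.mk ⟨x, hT x x.2⟩, fun i => ⟨⌊c x i⌋, by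
      have := abs_le.mp (hc1 x x.2 i)
      rw [Finset.mem_Icc]
      refine ⟨Int.le_floor.mpr (by push_cast; exact this.1), ?_⟩
      have h := (Int.floor_le (c x i)).trans this.2
      exact_mod_cast h⟩)
  have hφ : Function.Injective φ := by
    intro x y hxy
    have h1 := congrArg Prod.fst hxy
    have h2 := congrArg Prod.snd hxy
    simp only [φ] at h1 h2
    rw [Submodule.Quotient.eq, Submodule.mem_span_range_iff_exists_fun] at h1
    obtain ⟨z, hz⟩ := h1
    have hz' : ∑ i, (z i : ℝ) • u i = ∑ i, (c x i - c y i) • u i := by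
      have := congrArg (Submodule.subtype Λ) hz
      rw [map_sum] at this
      simp only [Submodule.subtype_apply, Submodule.coe_smul, u', Submodule.coe_sub] at this
      simp_rw [sub_smul, Finset.sum_sub_distrib, ← hc2 _ x.2, ← hc2 _ y.2, ← this,
        Int.cast_smul_eq_zsmul]
    have hcz : ∀ i, (z i : ℝ) = c x i - c y i := fun i => by
      have h0 : ∑ i, ((z i : ℝ) - (c x i - c y i)) • u i = 0 := by
        simp_rw [sub_smul _ (c x _ - c y _), Finset.sum_sub_distrib, hz', sub_self]
      have := Fintype.linearIndependent_iff.mp hli _ h0 i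
      linarith
    have hfl : ∀ i, c x i = c y i := fun i => by
      have h3 : ⌊c x i⌋ = ⌊c y i⌋ := congrArg Subtype.val (congrFun h2 i)
      have h4 := Int.abs_sub_lt_one_of_floor_eq_floor h3
      rw [← hcz i] at h4
      have h5 : |z i| < 1 := by exact_mod_cast h4
      have h6 : z i = 0 := Int.abs_lt_one_iff.mp h5
      have h7 := hcz i
      rw [h6] at h7
      push_cast at h7
      linarith
    apply Subtype.ext
    rw [hc2 _ x.2, hc2 _ y.2]
    simp_rw [hfl]
  have hle := Nat.card_le_card_of_injective φ hφ
  rw [Nat.card_prod, ← hindex] at hle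
  simp only [Nat.card_eq_fintype_card, Fintype.card_coe, Fintype.card_fun, Int.card_Icc] at hle
  have habs : ((bZ.det u').natAbs : ℝ) = |b.det u| := by
    rw [← hdet, Nat.cast_natAbs, Int.cast_abs]
  calc (T.card : ℝ) ≤ (((bZ.det u').natAbs * 3 ^ Fintype.card ι : ℕ) : ℝ) := by exact_mod_cast hle
    _ = 3 ^ Fintype.card ι * |b.det u| := by push_cast; rw [habs]; ring

/-- A determinant in an orthonormal basis is bounded by the product of the bounds for the
coordinates. -/
theorem abs_det_orthonormalBasis_le {ι V : Type*} [Fintype ι] [DecidableEq ι]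
    [NormedAddCommGroup V] [InnerProductSpace ℝ V] (e : OrthonormalBasis ι ℝ V) (u : ι → V)
    (M : ι → ι → ℝ) (hM : ∀ i j, |inner ℝ (e i) (u j)| ≤ M i j) :
    |e.toBasis.det u| ≤ ∑ σ : Equiv.Perm ι, ∏ i, M (σ i) i := by
  rw [Basis.det_apply, Matrix.det_apply]
  refine (Finset.abs_sum_le_sum_abs _ _).trans (Finset.sum_le_sum fun σ _ => ?_)
  have : |Equiv.Perm.sign σ • ∏ i, e.toBasis.toMatrix u (σ i) i| =
      |∏ i, e.toBasis.toMatrix u (σ i) i| := by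
    rcases Int.units_eq_one_or (Equiv.Perm.sign σ) with h | h <;> simp [h]
  rw [this, Finset.abs_prod]
  refine Finset.prod_le_prod (fun _ _ => abs_nonneg _) fun i _ => ?_
  simpa [Basis.toMatrix_apply, OrthonormalBasis.coe_toBasis_repr_apply,
    OrthonormalBasis.repr_apply_apply] using hM (σ i) i

/-- Changing to an orthonormal basis multiplies determinants by a factor whose absolute value does
not depend on the orthonormal basis. -/
theorem abs_det_eq_mul_abs_det {ι V : Type*} [Fintype ι] [DecidableEq ι]
    [NormedAddCommGroup V] [InnerProductSpace ℝ V] (b : Basis ι ℝ V)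
    (e₀ e : OrthonormalBasis ι ℝ V) (u : ι → V) :
    |b.det u| = |b.det e₀| * |e.toBasis.det u| := by
  have h1 : b.det u = b.det e * e.toBasis.det u := by
    have := congrArg (fun g => g u) (b.det.eq_smul_basis_det e.toBasis)
    simpa using this
  have h2 : b.det e = b.det e₀ * e₀.toBasis.det e := by
    have := congrArg (fun g => g e) (b.det.eq_smul_basis_det e₀.toBasis)
    simpa using this
  rw [h1, h2, abs_mul, abs_mul]
  rcases e₀.det_to_matrix_orthonormalBasis_real e with h | h <;> simp [h]

section LatticePoints

/-- A version of `exists_linearIndependent_abs_coord_le_one` for the differences to a base point. -/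
theorem exists_basis_of_differences {V : Type*} [AddCommGroup V] [Module ℝ V] {S : Set V}
    (hS : S.Finite) {x₀ : V} (hx₀ : x₀ ∈ S) {k : ℕ} (hk : finrank ℝ (vectorSpan ℝ S) = k) :
    ∃ u : Fin k → V, (∀ i, ∃ x ∈ S, u i = x - x₀) ∧ LinearIndependent ℝ u ∧
      ∀ x ∈ S, ∃ c : Fin k → ℝ, (∀ i, |c i| ≤ 1) ∧ x - x₀ = ∑ i, c i • u i := by
  rw [vectorSpan_eq_span_vsub_set_right ℝ hx₀] at hk
  subst hk
  obtain ⟨u, hu, hli, hc⟩ := exists_linearIndependent_abs_coord_le_one (hS.image (· -ᵥ x₀))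
  refine ⟨u, fun i => ?_, hli, fun x hx => hc _ ⟨x, hx, rfl⟩⟩
  obtain ⟨x, hx, h⟩ := hu i
  exact ⟨x, hx, h.symm⟩

variable {n : ℕ}

theorem abs_inner_sub_le {p x y : EuclideanSpace ℝ (Fin n)}
    {e : OrthonormalBasis (Fin n) ℝ (EuclideanSpace ℝ (Fin n))} {r : Fin n → ℝ}
    (hx : x ∈ box p e r) (hy : y ∈ box p e r) (i : Fin n) : |inner ℝ (e i) (x - y)| ≤ r i := by
  have h : x - y = (x - p) - (y - p) := by abel
  rw [h, inner_sub_right]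
  exact (abs_sub _ _).trans (by linarith [hx i, hy i])

theorem nonneg_of_mem_box {p x : EuclideanSpace ℝ (Fin n)}
    {e : OrthonormalBasis (Fin n) ℝ (EuclideanSpace ℝ (Fin n))} {r : Fin n → ℝ}
    (hx : x ∈ box p e r) (i : Fin n) : 0 ≤ r i := by
  linarith [hx i, abs_nonneg (inner ℝ (e i) (x - p))]

/-- If the lattice points in a box span the whole space, their number is at most comparable to the
volume of the box. -/
theorem card_le_of_finrank_eq
    (b : Basis (Fin n) ℝ (EuclideanSpace ℝ (Fin n))) (S : Finset (EuclideanSpace ℝ (Fin n)))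
    (hS : ∀ x ∈ S, x ∈ Submodule.span ℤ (Set.range b)) {x₀ : EuclideanSpace ℝ (Fin n)}
    (hx₀ : x₀ ∈ S) (hd : finrank ℝ (vectorSpan ℝ (S : Set (EuclideanSpace ℝ (Fin n)))) = n)
    {p : EuclideanSpace ℝ (Fin n)} {e : OrthonormalBasis (Fin n) ℝ (EuclideanSpace ℝ (Fin n))}
    {r : Fin n → ℝ} (hbox : ∀ x ∈ S, x ∈ box p e r) :
    (S.card : ℝ) ≤
      3 ^ n * |b.det (EuclideanSpace.basisFun (Fin n) ℝ)| * n.factorial * ∏ i, r i := by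
  classical
  obtain ⟨u, hu, hli, hc⟩ := exists_basis_of_differences S.finite_toSet (Finset.mem_coe.mpr hx₀) hd
  have h1 := card_le_three_pow_mul_abs_det b (u := u) (fun i => by
      obtain ⟨x, hx, h⟩ := hu i
      rw [h]
      exact Submodule.sub_mem _ (hS x hx) (hS x₀ hx₀)) hli (S.image (· - x₀)) (by
      simp only [Finset.mem_image]
      rintro _ ⟨x, hx, rfl⟩
      exact Submodule.sub_mem _ (hS x hx) (hS x₀ hx₀)) (by
      simp only [Finset.mem_image]
      rintro _ ⟨x, hx, rfl⟩
      exact hc x hx)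
  rw [Finset.card_image_of_injective _ (sub_left_injective), Fintype.card_fin,
    abs_det_eq_mul_abs_det b (EuclideanSpace.basisFun (Fin n) ℝ) e] at h1
  have h2 : |e.toBasis.det u| ≤ n.factorial * ∏ i, r i := by
    refine (abs_det_orthonormalBasis_le e u (fun i _ => r i) fun i j => ?_).trans ?_
    · obtain ⟨x, hx, h⟩ := hu j
      rw [h]
      exact abs_inner_sub_le (hbox x hx) (hbox x₀ hx₀) i
    · simp_rw [fun σ : Equiv.Perm (Fin n) => Equiv.prod_comp σ r]
      simp [Fintype.card_perm]
  calc (S.card : ℝ) ≤ _ := h1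
    _ ≤ 3 ^ n * (|b.det (EuclideanSpace.basisFun (Fin n) ℝ)| * (n.factorial * ∏ i, r i)) := by
        gcongr
    _ = _ := by ring

/-- If the lattice points in a box span a hyperplane, a normal vector `ξ` of this hyperplane can be
chosen in the dual lattice, with coordinates in the axes of the box that decrease with the number of
lattice points. With `u` a basis of the hyperplane from differences of the points, `ξ` represents
the functional `w ↦ det (w, u) / g`, where `g` generates the set of values of `w ↦ det (w, u)` on
the lattice. The number of points is at most `3 ^ (k + 1) * |g|`, since `g` is the determinant of
`u` completed by a lattice vector. -/
theorem exists_dual_vector {k : ℕ}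
    (b : Basis (Fin (k + 1)) ℝ (EuclideanSpace ℝ (Fin (k + 1))))
    (S : Finset (EuclideanSpace ℝ (Fin (k + 1))))
    (hS : ∀ x ∈ S, x ∈ Submodule.span ℤ (Set.range b)) {x₀ : EuclideanSpace ℝ (Fin (k + 1))}
    (hx₀ : x₀ ∈ S)
    (hd : finrank ℝ (vectorSpan ℝ (S : Set (EuclideanSpace ℝ (Fin (k + 1))))) = k)
    {p : EuclideanSpace ℝ (Fin (k + 1))}
    {e : OrthonormalBasis (Fin (k + 1)) ℝ (EuclideanSpace ℝ (Fin (k + 1)))}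
    {r : Fin (k + 1) → ℝ} (hbox : ∀ x ∈ S, x ∈ box p e r) :
    ∃ ξ : EuclideanSpace ℝ (Fin (k + 1)), ξ ≠ 0 ∧ (∀ i, ∃ z : ℤ, inner ℝ ξ (b i) = z) ∧
      ∀ j, |inner ℝ ξ (e j)| * S.card ≤
        3 ^ (k + 1) * |b.det (EuclideanSpace.basisFun (Fin (k + 1)) ℝ)| * (k + 1).factorial *
          ∏ i ∈ Finset.univ.erase j, r i := by
  classical
  obtain ⟨u, hu, hli, hc⟩ := exists_basis_of_differences S.finite_toSet (Finset.mem_coe.mpr hx₀) hd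
  have huΛ : ∀ i, u i ∈ Submodule.span ℤ (Set.range b) := fun i => by
    obtain ⟨x, hx, h⟩ := hu i
    rw [h]
    exact Submodule.sub_mem _ (hS x hx) (hS x₀ hx₀)
  set Λ := Submodule.span ℤ (Set.range b) with hΛ
  let F : EuclideanSpace ℝ (Fin (k + 1)) →ₗ[ℝ] ℝ :=
    { toFun := fun w => b.det.curryLeft w u
      map_add' := fun x y => by simp only [map_add, AlternatingMap.add_apply]
      map_smul' := fun c x => by simp only [map_smul, AlternatingMap.smul_apply, RingHom.id_apply] }
  have hF : ∀ w, F w = b.det (Fin.cons w u) := fun w => rfl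
  let u' : Fin k → Λ := fun i => ⟨u i, huΛ i⟩
  let f : Λ →ₗ[ℤ] ℤ :=
    { toFun := fun w => (b.restrictScalars ℤ).det.curryLeft w u'
      map_add' := fun x y => by simp only [map_add, AlternatingMap.add_apply]
      map_smul' := fun c x => by simp only [map_smul, AlternatingMap.smul_apply, RingHom.id_apply] }
  have hfF : ∀ w : Λ, ((f w : ℤ) : ℝ) = F w := fun w => by
    have h := cast_det_restrictScalars b (Fin.cons w u' : Fin (k + 1) → Λ)
    refine h.trans ?_
    rw [hF]
    congr 1
    funext i
    refine Fin.cases ?_ (fun i => ?_) i <;> simp [u']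
  -- The functional does not vanish: it is nonzero on any vector that completes `u` to a basis.
  have hfne : f ≠ 0 := by
    intro h0
    have hFb : F = 0 := b.ext fun i => by
      have := hfF ⟨b i, Submodule.subset_span ⟨i, rfl⟩⟩
      rw [h0] at this
      simpa using this.symm
    have hlt : Submodule.span ℝ (Set.range u) ≠ ⊤ := by
      intro h
      have h1 := finrank_span_eq_card hli
      rw [h, finrank_top, finrank_euclideanSpace, Fintype.card_fin, Fintype.card_fin] at h1
      omega
    obtain ⟨v, -, hv⟩ := SetLike.exists_of_lt (lt_top_iff_ne_top.mpr hlt)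
    have hli2 : LinearIndependent ℝ (Fin.cons v u : Fin (k + 1) → _) :=
      linearIndependent_finCons.mpr ⟨hli, hv⟩
    have hsp := hli2.span_eq_top_of_card_eq_finrank' (finrank_eq_card_basis b).symm
    have h2 := (b.is_basis_iff_det.mp ⟨hli2, hsp⟩).ne_zero
    rw [← hF, hFb] at h2
    exact h2 rfl
  set g : ℤ := Submodule.IsPrincipal.generator (LinearMap.range f) with hg
  have hg0 : g ≠ 0 := by
    intro h
    have := (Submodule.IsPrincipal.eq_bot_iff_generator_eq_zero (LinearMap.range f)).mpr h
    exact hfne (LinearMap.range_eq_bot.mp this)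
  have hgR : (g : ℝ) ≠ 0 := by exact_mod_cast hg0
  obtain ⟨w₀, hw₀⟩ : g ∈ LinearMap.range f := Submodule.IsPrincipal.generator_mem _
  have hFw₀ : F w₀ = g := by rw [← hfF, hw₀]
  have hcard : (S.card : ℝ) ≤ 3 ^ (k + 1) * |(g : ℝ)| := by
    have hw₀u : (w₀ : EuclideanSpace ℝ (Fin (k + 1))) ∉ Submodule.span ℝ (Set.range u) := by
      intro hmem
      rw [Submodule.mem_span_range_iff_exists_fun] at hmem
      obtain ⟨c, hc⟩ := hmem
      apply hgR
      rw [← hFw₀, ← hc, map_sum]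
      refine Finset.sum_eq_zero fun i _ => ?_
      rw [map_smul, hF, b.det.map_eq_zero_of_eq (i := 0) (j := i.succ) _ (by simp)
        (Fin.succ_ne_zero i).symm, smul_zero]
    have h1 := card_le_three_pow_mul_abs_det b
      (u := (Fin.cons (w₀ : EuclideanSpace ℝ (Fin (k + 1))) u : Fin (k + 1) → _)) (fun i => by
        refine Fin.cases ?_ (fun i => ?_) i
        · exact w₀.2
        · exact huΛ i) (linearIndependent_finCons.mpr ⟨hli, hw₀u⟩) (S.image (· - x₀)) (by
        simp only [Finset.mem_image]
        rintro _ ⟨x, hx, rfl⟩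
        exact Submodule.sub_mem _ (hS x hx) (hS x₀ hx₀)) (by
        simp only [Finset.mem_image]
        rintro _ ⟨x, hx, rfl⟩
        obtain ⟨c, hc1, hc2⟩ := hc x hx
        refine ⟨Fin.cons 0 c, fun i => ?_, ?_⟩
        · refine Fin.cases ?_ (fun i => ?_) i
          · simp
          · simpa using hc1 i
        · simpa [Fin.sum_univ_succ] using hc2)
    rw [Finset.card_image_of_injective _ (sub_left_injective), Fintype.card_fin, ← hF, hFw₀] at h1
    exact h1
  let ξ : EuclideanSpace ℝ (Fin (k + 1)) :=
    (g : ℝ)⁻¹ • (InnerProductSpace.toDual ℝ _).symm F.toContinuousLinearMap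
  have hξ : ∀ w, inner ℝ ξ w = (g : ℝ)⁻¹ * F w := fun w => by
    simp only [ξ, real_inner_smul_left, InnerProductSpace.toDual_symm_apply]
    rfl
  refine ⟨ξ, ?_, fun i => ?_, fun j => ?_⟩
  · intro h
    have := hξ w₀
    rw [h, inner_zero_left, hFw₀, inv_mul_cancel₀ hgR] at this
    exact zero_ne_one this
  · have hmem : f ⟨b i, Submodule.subset_span ⟨i, rfl⟩⟩ ∈ LinearMap.range f := ⟨_, rfl⟩
    obtain ⟨z, hz⟩ := (Submodule.IsPrincipal.mem_iff_eq_smul_generator _).mp hmem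
    refine ⟨z, ?_⟩
    rw [hξ, ← hfF ⟨b i, Submodule.subset_span ⟨i, rfl⟩⟩, hz, smul_eq_mul, ← hg]
    push_cast
    field_simp
  · have hr : ∀ i, 0 ≤ r i := nonneg_of_mem_box (hbox x₀ hx₀)
    have hdet : |F (e j)| ≤ |b.det (EuclideanSpace.basisFun (Fin (k + 1)) ℝ)| *
        ((k + 1).factorial * ∏ i ∈ Finset.univ.erase j, r i) := by
      rw [hF, abs_det_eq_mul_abs_det b (EuclideanSpace.basisFun (Fin (k + 1)) ℝ) e]
      gcongr
      refine (abs_det_orthonormalBasis_le e _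
        (fun i l => Fin.cases (if i = j then 1 else 0) (fun _ => r i) l) fun i l => ?_).trans ?_
      · refine Fin.cases ?_ (fun l => ?_) l
        · simp only [Fin.cons_zero, Fin.cases_zero, e.inner_eq_ite]
          split_ifs <;> simp
        · obtain ⟨x, hx, h⟩ := hu l
          simp only [Fin.cons_succ, Fin.cases_succ, h]
          exact abs_inner_sub_le (hbox x hx) (hbox x₀ hx₀) i
      · -- Only permutations with `σ 0 = j` contribute, and for them `r j` does not occur.
        have hprod : ∏ i ∈ Finset.univ.erase j, r i = ∏ i, Function.update r j 1 i := by
          rw [Finset.prod_update_of_mem (Finset.mem_univ j), one_mul, Finset.sdiff_singleton_eq_erase]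
        have hterm : ∀ σ : Equiv.Perm (Fin (k + 1)),
            ∏ l, (Fin.cases (if σ l = j then 1 else 0) (fun _ => r (σ l)) l : ℝ) ≤
              ∏ i ∈ Finset.univ.erase j, r i := by
          intro σ
          by_cases hσ : σ 0 = j
          · rw [hprod, ← Equiv.prod_comp σ (Function.update r j 1)]
            refine Finset.prod_le_prod (fun l _ => ?_) fun l _ => ?_
            · refine Fin.cases ?_ (fun l => ?_) l
              · simp [hσ]
              · exact hr _
            · refine Fin.cases ?_ (fun l => ?_) l
              · simp [hσ]
              · have : σ l.succ ≠ j := by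
                  rw [← hσ]
                  exact fun h => Fin.succ_ne_zero l (σ.injective h)
                simp [this]
          · rw [Fin.prod_univ_succ]
            simp only [Fin.cases_zero, hσ, if_false, zero_mul]
            exact Finset.prod_nonneg fun i _ => hr i
        refine (Finset.sum_le_sum fun σ _ => hterm σ).trans ?_
        simp [Fintype.card_perm]
    rw [hξ, abs_mul, abs_inv]
    have hgpos : 0 < |(g : ℝ)| := abs_pos.mpr hgR
    calc |(g : ℝ)|⁻¹ * |F (e j)| * S.card
        ≤ |(g : ℝ)|⁻¹ * |F (e j)| * (3 ^ (k + 1) * |(g : ℝ)|) := by gcongr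
      _ = 3 ^ (k + 1) * |F (e j)| := by field_simp
      _ ≤ 3 ^ (k + 1) * (|b.det (EuclideanSpace.basisFun (Fin (k + 1)) ℝ)| *
        ((k + 1).factorial * ∏ i ∈ Finset.univ.erase j, r i)) := by gcongr
      _ = _ := by ring

/-- The points of a lattice are uniformly separated. -/
theorem exists_le_norm_of_mem_span (b : Basis (Fin n) ℝ (EuclideanSpace ℝ (Fin n))) :
    ∃ s : ℝ, 0 < s ∧ ∀ x ∈ Submodule.span ℤ (Set.range b), x ≠ 0 → s ≤ ‖x‖ := by
  set T := (b.equivFunL : EuclideanSpace ℝ (Fin n) →L[ℝ] (Fin n → ℝ))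
  refine ⟨(‖T‖ + 1)⁻¹, by positivity, fun x hx hx0 => ?_⟩
  have h1 : 1 ≤ ‖T x‖ := by
    have hne : b.repr x ≠ 0 := by simpa using hx0
    obtain ⟨i, hi⟩ := Finsupp.ne_iff.mp hne
    obtain ⟨z, hz⟩ := (b.mem_span_iff_repr_mem ℤ x).mp hx i
    have hz0 : z ≠ 0 := by
      rintro rfl
      simp [← hz] at hi
    have h2 : (1 : ℝ) ≤ |(z : ℝ)| := by exact_mod_cast Int.one_le_abs hz0
    calc (1 : ℝ) ≤ |(z : ℝ)| := h2
      _ = ‖T x i‖ := by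
        rw [Real.norm_eq_abs]
        congr 1
      _ ≤ ‖T x‖ := norm_le_pi_norm _ i
  have h2 := T.le_opNorm x
  rw [inv_le_iff_one_le_mul₀ (by positivity)]
  nlinarith [norm_nonneg x]

open MeasureTheory in
/-- Separated points of a ball that span an affine subspace of dimension `k` are packed in a
ball of dimension `k`. -/
theorem card_le_of_separated {V : Type*} [NormedAddCommGroup V] [InnerProductSpace ℝ V]
    [FiniteDimensional ℝ V] [MeasurableSpace V] [BorelSpace V] (S : Finset V) {x₀ : V}
    (hx₀ : x₀ ∈ S) {s ρ : ℝ} (hs : 0 < s) (hρ : 0 ≤ ρ)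
    (hsep : ∀ x ∈ S, ∀ y ∈ S, x ≠ y → s ≤ ‖x - y‖) (hball : ∀ x ∈ S, ‖x - x₀‖ ≤ ρ) :
    (S.card : ℝ) ≤ (1 + 2 * ρ / s) ^ finrank ℝ (vectorSpan ℝ (S : Set V)) := by
  classical
  set W := vectorSpan ℝ (S : Set V)
  let φ : S → W := fun x => ⟨x - x₀, vsub_mem_vectorSpan ℝ x.2 hx₀⟩
  have hdisj : ((Finset.univ : Finset S) : Set S).PairwiseDisjoint
      (fun x => Metric.ball (φ x) (s / 2)) := by
    intro x _ y _ hxy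
    refine Metric.ball_disjoint_ball ?_
    have h := hsep x x.2 y y.2 (fun h => hxy (Subtype.ext h))
    rw [dist_eq_norm]
    have : ‖φ x - φ y‖ = ‖(x : V) - y‖ := by
      simp [φ]
    linarith
  have hsub : (⋃ x ∈ (Finset.univ : Finset S), Metric.ball (φ x) (s / 2)) ⊆
      Metric.ball (0 : W) (ρ + s / 2) := by
    refine Set.iUnion₂_subset fun x _ => Metric.ball_subset_ball' ?_
    have h : dist (φ x) 0 = ‖(x : V) - x₀‖ := by simp [φ]
    rw [h]
    linarith [hball x x.2]
  have hμ := measure_mono (μ := (volume : Measure W)) hsub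
  rw [measure_biUnion_finset hdisj (fun _ _ => measurableSet_ball)] at hμ
  simp_rw [fun x => Measure.addHaar_ball_of_pos (volume : Measure W) x (half_pos hs),
    Measure.addHaar_ball_of_pos (volume : Measure W) 0 (by positivity : 0 < ρ + s / 2)] at hμ
  rw [Finset.sum_const, nsmul_eq_mul, ← mul_assoc] at hμ
  have hpos : (volume : Measure W) (Metric.ball 0 1) ≠ 0 :=
    (Metric.measure_ball_pos _ _ one_pos).ne'
  have hfin : (volume : Measure W) (Metric.ball 0 1) ≠ ⊤ := measure_ball_lt_top.ne
  rw [ENNReal.mul_le_mul_iff_left hpos hfin, ← ENNReal.ofReal_natCast,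
    ← ENNReal.ofReal_mul (by positivity), ENNReal.ofReal_le_ofReal_iff (by positivity)] at hμ
  rw [Finset.card_univ, Fintype.card_coe] at hμ
  have h2 : (1 + 2 * ρ / s) = (ρ + s / 2) / (s / 2) := by field_simp; ring
  rw [h2, div_pow, le_div_iff₀ (by positivity)]
  exact hμ

end LatticePoints

/-! ### Volumes of boxes and of conical sectors -/

section Volume

open MeasureTheory

variable {n : ℕ}

theorem measurableSet_box (p : EuclideanSpace ℝ (Fin n))
    (e : OrthonormalBasis (Fin n) ℝ (EuclideanSpace ℝ (Fin n))) (r : Fin n → ℝ) :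
    MeasurableSet (box p e r) := by
  have : box p e r = ⋂ i, {x | |inner ℝ (e i) (x - p)| ≤ r i / 2} := by
    ext x; simp [box]
  rw [this]
  refine MeasurableSet.iInter fun i => ?_
  refine measurableSet_le ?_ measurable_const
  exact Continuous.measurable (by fun_prop)

theorem volume_box (p : EuclideanSpace ℝ (Fin n))
    (e : OrthonormalBasis (Fin n) ℝ (EuclideanSpace ℝ (Fin n))) {r : Fin n → ℝ}
    (hr : ∀ i, 0 ≤ r i) : volume (box p e r) = ENNReal.ofReal (∏ i, r i) := by
  have h1 : MeasurePreserving (fun x : EuclideanSpace ℝ (Fin n) => (e.repr (x - p)).ofLp) :=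
    ((EuclideanSpace.volume_preserving_symm_measurableEquiv_toLp (Fin n)).comp
      e.measurePreserving_repr).comp (measurePreserving_sub_right volume p)
  have h2 : box p e r = (fun x : EuclideanSpace ℝ (Fin n) => (e.repr (x - p)).ofLp) ⁻¹'
      Set.Icc (fun i => -(r i / 2)) (fun i => r i / 2) := by
    ext x
    simp only [box, Set.mem_ofPred_eq, Set.mem_preimage, Set.mem_Icc, Pi.le_def,
      OrthonormalBasis.repr_apply_apply, abs_le, forall_and]
  rw [h2, h1.measure_preimage measurableSet_Icc.nullMeasurableSet, Real.volume_Icc_pi,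
    ENNReal.ofReal_prod_of_nonneg fun i _ => hr i]
  congr 1
  funext i
  congr 1
  ring

/-- A family of sets of measure at least `v` in a set of measure at most `w`, no point of which
lies in more than `m` of them, has at most `m * w / v` members. -/
theorem finite_and_ncard_mul_le_of_overlap {α : Type*} [MeasurableSpace α] (μ : Measure α)
    {Ω : Set (Set α)} {U : Set α} {m : ℕ} {v w : ℝ} (hv : 0 < v) (hw : 0 ≤ w)
    (hmeas : ∀ ω ∈ Ω, MeasurableSet ω) (hsub : ∀ ω ∈ Ω, ω ⊆ U)
    (hvol : ∀ ω ∈ Ω, ENNReal.ofReal v ≤ μ ω) (hU : μ U ≤ ENNReal.ofReal w)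
    (hover : ∀ x, {ω ∈ Ω | x ∈ ω}.encard ≤ m) :
    Ω.Finite ∧ (Ω.ncard : ℝ) * v ≤ m * w := by
  classical
  have key : ∀ F : Finset (Set α), (F : Set (Set α)) ⊆ Ω → (F.card : ℝ) * v ≤ m * w := by
    intro F hF
    have h1 : (F.card : ENNReal) * ENNReal.ofReal v ≤ m * ENNReal.ofReal w := by
      calc (F.card : ENNReal) * ENNReal.ofReal v = ∑ ω ∈ F, ENNReal.ofReal v := by
            rw [Finset.sum_const, nsmul_eq_mul]
        _ ≤ ∑ ω ∈ F, μ ω := Finset.sum_le_sum fun ω hω => hvol ω (hF hω)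
        _ = ∑ ω ∈ F, ∫⁻ x in U, ω.indicator 1 x ∂μ := by
            refine Finset.sum_congr rfl fun ω hω => ?_
            rw [lintegral_indicator_one (hmeas ω (hF hω)), Measure.restrict_apply (hmeas ω (hF hω)),
              Set.inter_eq_left.mpr (hsub ω (hF hω))]
        _ = ∫⁻ x in U, ∑ ω ∈ F, ω.indicator 1 x ∂μ := by
            rw [lintegral_finsetSum']
            exact fun ω hω => (measurable_one.indicator (hmeas ω (hF hω))).aemeasurable
        _ ≤ ∫⁻ _ in U, (m : ENNReal) ∂μ := by
            refine lintegral_mono fun x => ?_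
            have h2 : ∑ ω ∈ F, ω.indicator (1 : α → ENNReal) x =
                ((F.filter (fun ω => x ∈ ω)).card : ENNReal) := by
              simp [Set.indicator_apply]
            have h3 : ((F.filter (fun ω => x ∈ ω)).card : ℕ∞) ≤ m := by
              refine le_trans ?_ (hover x)
              rw [← Set.encard_coe_eq_coe_finsetCard]
              refine Set.encard_le_encard fun ω hω => ?_
              simp only [Finset.coe_filter, Set.mem_ofPred_eq] at hω
              exact ⟨hF hω.1, hω.2⟩
            simp only [h2]
            exact_mod_cast h3
        _ = m * μ U := by simp
        _ ≤ m * ENNReal.ofReal w := by gcongr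
    rw [← ENNReal.ofReal_natCast, ← ENNReal.ofReal_natCast, ← ENNReal.ofReal_mul (by positivity),
      ← ENNReal.ofReal_mul (by positivity), ENNReal.ofReal_le_ofReal_iff (by positivity)] at h1
    exact h1
  have hfin : Ω.Finite := by
    by_contra hinf
    obtain ⟨N, hN⟩ := exists_nat_gt (m * w / v)
    obtain ⟨F, hF, hcard⟩ := Set.Infinite.exists_subset_card_eq hinf N
    have := key F hF
    rw [hcard] at this
    rw [div_lt_iff₀ hv] at hN
    linarith
  refine ⟨hfin, ?_⟩
  have := key hfin.toFinset (by simp)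
  rwa [← Set.ncard_eq_toFinset_card Ω hfin] at this

/-- The double cone of opening `τ` about the line spanned by the unit vector `f`. -/
def doubleCone (f : EuclideanSpace ℝ (Fin n)) (τ : ℝ) : Set (EuclideanSpace ℝ (Fin n)) :=
  {x | ‖x - inner ℝ f x • f‖ ≤ τ * ‖x‖}

theorem measurableSet_doubleCone (f : EuclideanSpace ℝ (Fin n)) (τ : ℝ) :
    MeasurableSet (doubleCone f τ) :=
  measurableSet_le (Continuous.measurable (by fun_prop)) (Continuous.measurable (by fun_prop))

/-- In an orthonormal basis starting with `f`, the cone in the unit ball lies in a box with one side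
of length `2` and all others of length `2 * τ`. -/
theorem volume_doubleCone_inter_ball_one_le {k : ℕ} {f : EuclideanSpace ℝ (Fin (k + 1))}
    (hf : ‖f‖ = 1) {τ : ℝ} (hτ : 0 ≤ τ) :
    volume (doubleCone f τ ∩ Metric.ball 0 1) ≤ ENNReal.ofReal (2 ^ (k + 1) * τ ^ k) := by
  obtain ⟨e, he⟩ := Orthonormal.exists_orthonormalBasis_extension_of_card_eq (𝕜 := ℝ)
    (ι := Fin (k + 1)) (by simp) (v := fun _ => f) (s := {0}) (by
      refine ⟨fun i => by simpa using hf, fun i i' h => (h (Subsingleton.elim _ _)).elim⟩)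
  have he0 : e 0 = f := he 0 rfl
  have hsub : doubleCone f τ ∩ Metric.ball 0 1 ⊆ box 0 e (Fin.cons 2 fun _ => 2 * τ) := by
    rintro x ⟨hx, hx1⟩
    have hx1 : ‖x‖ ≤ 1 := by
      rw [mem_ball_zero_iff] at hx1
      exact hx1.le
    intro i
    refine Fin.cases ?_ (fun i => ?_) i
    · have := abs_real_inner_le_norm (e 0) x
      rw [e.norm_eq_one, one_mul] at this
      simpa using this.trans hx1
    · have h1 : inner ℝ (e i.succ) (x - inner ℝ f x • f) = inner ℝ (e i.succ) x := by
        rw [inner_sub_right, inner_smul_right, ← he0, e.inner_eq_ite, if_neg (Fin.succ_ne_zero i)]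
        ring
      have h2 := abs_real_inner_le_norm (e i.succ) (x - inner ℝ f x • f)
      rw [h1, e.norm_eq_one, one_mul] at h2
      have h3 : |inner ℝ (e i.succ) x| ≤ τ :=
        h2.trans (hx.trans (by nlinarith))
      simpa using h3
  refine (measure_mono hsub).trans ?_
  rw [volume_box]
  · refine ENNReal.ofReal_le_ofReal (le_of_eq ?_)
    rw [Fin.prod_univ_succ]
    simp only [Fin.cons_zero, Fin.cons_succ, Finset.prod_const, Finset.card_univ, Fintype.card_fin]
    ring
  · intro i
    refine Fin.cases ?_ (fun i => ?_) i
    · simp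
    · simpa using hτ

open scoped Pointwise in
theorem volume_doubleCone_inter_ball (f : EuclideanSpace ℝ (Fin n)) (τ : ℝ) (hn : n ≠ 0) {ρ : ℝ}
    (hρ : 0 ≤ ρ) : volume (doubleCone f τ ∩ Metric.ball 0 ρ) =
      ENNReal.ofReal (ρ ^ n) * volume (doubleCone f τ ∩ Metric.ball 0 1) := by
  rcases hρ.eq_or_lt with rfl | hρ
  · simp [hn]
  have h : doubleCone f τ ∩ Metric.ball 0 ρ = ρ • (doubleCone f τ ∩ Metric.ball 0 1) := by
    ext x
    rw [Set.mem_smul_set_iff_inv_smul_mem₀ hρ.ne']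
    simp only [Set.mem_inter_iff, doubleCone, Set.mem_ofPred_eq, mem_ball_zero_iff,
      inner_smul_right, norm_smul, norm_inv, Real.norm_eq_abs, abs_of_pos hρ, mul_smul]
    rw [← smul_sub, norm_smul, norm_inv, Real.norm_eq_abs, abs_of_pos hρ, inv_mul_lt_iff₀ hρ,
      mul_one, mul_left_comm, mul_le_mul_iff_right₀ (inv_pos.mpr hρ)]
  rw [h, Measure.addHaar_smul_of_nonneg _ hρ.le]
  simp

/-- By homogeneity the part of an annulus in a double cone has the proportion of the annulus that
the cone has of the ball. -/
theorem volume_doubleCone_inter_annulus_le {k : ℕ} {f : EuclideanSpace ℝ (Fin (k + 1))}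
    (hf : ‖f‖ = 1) {τ : ℝ} (hτ : 0 ≤ τ) {lam w : ℝ} (hlam : 0 ≤ lam) (hw : 0 ≤ w) :
    volume (doubleCone f τ ∩ annulus (k + 1) lam w) ≤
      ENNReal.ofReal (2 ^ (k + 1) * τ ^ k * ((k + 1) * (lam + w) ^ k * (2 * w))) := by
  set ρ := max 0 (lam - w)
  have hρ : 0 ≤ ρ := le_max_left _ _
  have hρ2 : ρ ≤ lam + w := max_le (by linarith) (by linarith)
  have hρ3 : lam + w - ρ ≤ 2 * w := by linarith [le_max_right 0 (lam - w)]
  have hsub : doubleCone f τ ∩ annulus (k + 1) lam w ⊆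
      (doubleCone f τ ∩ Metric.ball 0 (lam + w)) \ (doubleCone f τ ∩ Metric.ball 0 ρ) := by
    rintro x ⟨hx, hx2⟩
    have hx3 := abs_lt.mp (show |‖x‖ - lam| < w from hx2)
    refine ⟨⟨hx, by rw [mem_ball_zero_iff]; linarith⟩, fun h => ?_⟩
    have h2 : ‖x‖ < ρ := by simpa using h.2
    rcases lt_max_iff.mp h2 with h3 | h3
    · linarith [norm_nonneg x]
    · linarith
  refine (measure_mono hsub).trans ?_
  rw [measure_sdiff (Set.inter_subset_inter_right _ (Metric.ball_subset_ball hρ2))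
    ((measurableSet_doubleCone f τ).inter measurableSet_ball).nullMeasurableSet
    (measure_inter_lt_top_of_right_ne_top measure_ball_lt_top.ne).ne,
    volume_doubleCone_inter_ball f τ (Nat.succ_ne_zero k) hρ,
    volume_doubleCone_inter_ball f τ (Nat.succ_ne_zero k) (hρ.trans hρ2),
    ← ENNReal.sub_mul fun _ _ => measure_inter_lt_top_of_right_ne_top measure_ball_lt_top.ne |>.ne,
    ← ENNReal.ofReal_sub _ (by positivity), mul_comm (2 ^ (k + 1) * τ ^ k),
    ENNReal.ofReal_mul (by positivity)]
  refine mul_le_mul' (ENNReal.ofReal_le_ofReal ?_) (volume_doubleCone_inter_ball_one_le hf hτ)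
  have h := abs_pow_sub_pow_le (lam + w) ρ (k + 1)
  rw [abs_of_nonneg (sub_nonneg.mpr hρ2), abs_of_nonneg (hρ.trans hρ2), abs_of_nonneg hρ,
    max_eq_left hρ2] at h
  refine (le_abs_self _).trans (h.trans ?_)
  simp only [Nat.add_sub_cancel, Nat.cast_add, Nat.cast_one]
  have h0 : 0 ≤ lam + w := hρ.trans hρ2
  calc (lam + w - ρ) * (k + 1) * (lam + w) ^ k ≤ (2 * w) * (k + 1) * (lam + w) ^ k := by gcongr
    _ = _ := by ring

end Volume

/-! ### Caps in an annulus -/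

section CapGeometry

variable {n : ℕ}

/-- A box in an annulus has its center almost orthogonal to its long axes. -/
theorem mul_abs_inner_center_le {p : EuclideanSpace ℝ (Fin n)}
    {e : OrthonormalBasis (Fin n) ℝ (EuclideanSpace ℝ (Fin n))} {r : Fin n → ℝ} {lam w : ℝ}
    (hr : ∀ i, 0 ≤ r i) (hsub : box p e r ⊆ annulus n lam w) (i : Fin n) :
    r i * |inner ℝ (e i) p| ≤ 2 * w * (lam + w) := by
  have hmem : ∀ t : ℝ, |t| ≤ r i / 2 → |‖p + t • e i‖ - lam| < w := by
    intro t ht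
    refine hsub fun l => ?_
    rw [add_sub_cancel_left, inner_smul_right, e.inner_eq_ite]
    split_ifs with h
    · rw [h, mul_one]; exact ht
    · simpa using (by linarith [hr l] : (0 : ℝ) ≤ r l / 2)
  have h1 := abs_lt.mp (hmem (r i / 2) (abs_of_nonneg (by linarith [hr i] : (0 : ℝ) ≤ r i / 2)).le)
  have h2 := abs_lt.mp (hmem (-(r i / 2))
    (by rw [abs_neg]; exact (abs_of_nonneg (by linarith [hr i] : (0 : ℝ) ≤ r i / 2)).le))
  set a := ‖p + (r i / 2) • e i‖
  set b := ‖p + (-(r i / 2)) • e i‖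
  have h3 : a ^ 2 - b ^ 2 = 2 * (r i * inner ℝ (e i) p) := by
    simp only [a, b]
    rw [norm_add_sq_real, norm_add_sq_real, norm_smul, norm_smul, norm_neg, inner_smul_right,
      inner_smul_right, real_inner_comm]
    ring
  have ha : 0 ≤ a := norm_nonneg _
  have hb : 0 ≤ b := norm_nonneg _
  have h4 : |a ^ 2 - b ^ 2| ≤ (2 * w) * (2 * (lam + w)) := by
    rw [sq_sub_sq, abs_mul, abs_of_nonneg (add_nonneg ha hb), mul_comm]
    have : |a - b| ≤ 2 * w := abs_le.mpr ⟨by linarith, by linarith⟩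
    exact mul_le_mul this (by linarith) (by positivity) ((abs_nonneg _).trans this)
  rw [h3, abs_mul, abs_mul, abs_of_nonneg (hr i), abs_two] at h4
  linarith

/-- The distance of `x` to the line spanned by `ξ` is controlled by the `2 × 2` minors of the pair
`x, ξ`, by Lagrange's identity. -/
theorem norm_mul_norm_sub_inner_smul_le
    (e : OrthonormalBasis (Fin n) ℝ (EuclideanSpace ℝ (Fin n))) (x ξ : EuclideanSpace ℝ (Fin n))
    (hξ : ξ ≠ 0) {B : ℝ} (hB : 0 ≤ B)
    (hminor : ∀ i l, |inner ℝ (e i) x * inner ℝ (e l) ξ - inner ℝ (e l) x * inner ℝ (e i) ξ| ≤ B) :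
    ‖ξ‖ * ‖x - inner ℝ (‖ξ‖⁻¹ • ξ) x • (‖ξ‖⁻¹ • ξ)‖ ≤ n * B := by
  have hξ0 : 0 < ‖ξ‖ := norm_pos_iff.mpr hξ
  have h1 : (‖ξ‖ * ‖x - inner ℝ (‖ξ‖⁻¹ • ξ) x • (‖ξ‖⁻¹ • ξ)‖) ^ 2 =
      ‖x‖ ^ 2 * ‖ξ‖ ^ 2 - (inner ℝ x ξ) ^ 2 := by
    rw [mul_pow, norm_sub_sq_real, norm_smul, norm_smul, norm_inv, norm_norm, inner_smul_right,
      inner_smul_right, inner_smul_left, real_inner_comm ξ x]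
    simp only [Real.norm_eq_abs, conj_trivial]
    rw [mul_pow, sq_abs]
    field_simp
    ring
  have h2 : 2 * (‖x‖ ^ 2 * ‖ξ‖ ^ 2 - (inner ℝ x ξ) ^ 2) = ∑ i, ∑ l,
      (inner ℝ (e i) x * inner ℝ (e l) ξ - inner ℝ (e l) x * inner ℝ (e i) ξ) ^ 2 := by
    have hx : ‖x‖ ^ 2 = ∑ i, inner ℝ (e i) x ^ 2 := by
      rw [← e.sum_sq_norm_inner_right x]; simp
    have hy : ‖ξ‖ ^ 2 = ∑ i, inner ℝ (e i) ξ ^ 2 := by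
      rw [← e.sum_sq_norm_inner_right ξ]; simp
    have hxy : inner ℝ x ξ = ∑ i, inner ℝ (e i) x * inner ℝ (e i) ξ := by
      rw [← e.sum_inner_mul_inner x ξ]
      simp_rw [real_inner_comm x]
    have h3 : ∀ i l, (inner ℝ (e i) x * inner ℝ (e l) ξ - inner ℝ (e l) x * inner ℝ (e i) ξ) ^ 2 =
        inner ℝ (e i) x ^ 2 * inner ℝ (e l) ξ ^ 2 + inner ℝ (e i) ξ ^ 2 * inner ℝ (e l) x ^ 2 -
        2 * ((inner ℝ (e i) x * inner ℝ (e i) ξ) * (inner ℝ (e l) x * inner ℝ (e l) ξ)) := by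
      intro i l; ring
    simp_rw [h3, Finset.sum_sub_distrib, Finset.sum_add_distrib, ← Finset.mul_sum,
      ← Finset.sum_mul]
    rw [hx, hy, hxy]
    ring
  have h3 : ∑ i, ∑ l,
      (inner ℝ (e i) x * inner ℝ (e l) ξ - inner ℝ (e l) x * inner ℝ (e i) ξ) ^ 2 ≤
      ∑ _i : Fin n, ∑ _l : Fin n, B ^ 2 :=
    Finset.sum_le_sum fun i _ => Finset.sum_le_sum fun l _ => sq_le_sq' (by
      linarith [(abs_le.mp (hminor i l)).1]) (abs_le.mp (hminor i l)).2
  simp only [Finset.sum_const, Finset.card_univ, Fintype.card_fin, nsmul_eq_mul] at h3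
  refine abs_le_of_sq_le_sq' ?_ (by positivity) |>.2
  rw [h1]
  nlinarith [sq_nonneg (n * B)]

/-- A cap in an annulus lies in a narrow double cone about any vector `ξ` that is almost orthogonal
to its long axes. -/
theorem box_subset_doubleCone {p : EuclideanSpace ℝ (Fin n)}
    {e : OrthonormalBasis (Fin n) ℝ (EuclideanSpace ℝ (Fin n))} {r : Fin n → ℝ} {j : Fin n}
    {A K lam δ R Y : ℝ} (hA : 1 ≤ A) (hK : 1 ≤ K) (hlam : 1 ≤ lam) (hlamK : 2 * K ≤ lam)
    (hδ : 0 < δ) (hδ1 : δ ≤ 1) (hR : 0 < R) (hR2 : R ^ 2 = lam * δ) (hr : ∀ i, 0 ≤ r i)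
    (hlong : ∀ i, i ≠ j → A⁻¹ * R ≤ r i ∧ r i ≤ A * R)
    (hsub : box p e r ⊆ annulus n lam (K * δ)) {ξ : EuclideanSpace ℝ (Fin n)} (hξ : ξ ≠ 0)
    (hY : 0 ≤ Y) (hξY : ∀ i, |inner ℝ (e i) ξ| ≤ Y)
    (hξR : ∀ i, i ≠ j → |inner ℝ (e i) ξ| ≤ Y * (R / lam)) :
    box p e r ⊆ doubleCone (‖ξ‖⁻¹ • ξ) (20 * n * A * K ^ 2 * (R * Y) / (lam * ‖ξ‖)) := by
  have hlam0 : 0 < lam := by linarith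
  have hξ0 : 0 < ‖ξ‖ := norm_pos_iff.mpr hξ
  have hKδ : K * δ ≤ K := by nlinarith
  have hKlam : K ≤ K * lam := by nlinarith
  intro x hx
  have hxn := abs_lt.mp (show |‖x‖ - lam| < K * δ from hsub hx)
  have hxup : ‖x‖ ≤ 2 * K * lam := by nlinarith
  have hxlow : lam / 2 ≤ ‖x‖ := by linarith
  have hAK : 1 ≤ A * K := by nlinarith
  have hKK : K ≤ K ^ 2 := by nlinarith
  have hAKK : 1 ≤ A * K ^ 2 := by nlinarith
  have hlongx : ∀ i, i ≠ j → |inner ℝ (e i) x| ≤ 5 * A * K ^ 2 * R := by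
    intro i hi
    have h1 := mul_abs_inner_center_le hr hsub i
    have h2 : R * |inner ℝ (e i) p| ≤ R * (4 * A * K ^ 2 * R) := by
      have h3 : A⁻¹ * R * |inner ℝ (e i) p| ≤ 2 * (K * δ) * (2 * K * lam) :=
        (mul_le_mul_of_nonneg_right (hlong i hi).1 (abs_nonneg _)).trans (h1.trans (by
          gcongr
          nlinarith))
      have h4 : A * (A⁻¹ * R * |inner ℝ (e i) p|) ≤ A * (2 * (K * δ) * (2 * K * lam)) := by gcongr
      rw [← mul_assoc, mul_inv_cancel_left₀ (by positivity)] at h4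
      calc R * |inner ℝ (e i) p| ≤ A * (2 * (K * δ) * (2 * K * lam)) := h4
        _ = 4 * A * K ^ 2 * (lam * δ) := by ring
        _ = R * (4 * A * K ^ 2 * R) := by rw [← hR2]; ring
    have h5 := le_of_mul_le_mul_left h2 hR
    have h6 : |inner ℝ (e i) (x - p)| ≤ A * R / 2 := (hx i).trans (by linarith [(hlong i hi).2])
    have h7 : inner ℝ (e i) x = inner ℝ (e i) (x - p) + inner ℝ (e i) p := by
      rw [inner_sub_right]; ring
    rw [h7]
    refine (abs_add_le _ _).trans ?_
    have h8 : A * R ≤ A * K ^ 2 * R := by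
      have : A ≤ A * K ^ 2 := by nlinarith
      gcongr
    nlinarith [mul_pos (by linarith : 0 < A) hR]
  have hprod : ∀ i l, i ≠ l → |inner ℝ (e i) x * inner ℝ (e l) ξ| ≤ 5 * A * K ^ 2 * (R * Y) := by
    intro i l hil
    rw [abs_mul]
    by_cases hi : i = j
    · have h1 : |inner ℝ (e i) x| ≤ 2 * K * lam := by
        have := abs_real_inner_le_norm (e i) x
        rw [e.norm_eq_one, one_mul] at this
        exact this.trans hxup
      have h2 := hξR l (fun h => hil (hi.trans h.symm))
      calc |inner ℝ (e i) x| * |inner ℝ (e l) ξ| ≤ (2 * K * lam) * (Y * (R / lam)) := by gcongr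
        _ = 2 * K * (R * Y) := by field_simp
        _ ≤ 5 * A * K ^ 2 * (R * Y) := by
          have : 2 * K ≤ 5 * A * K ^ 2 := by nlinarith
          gcongr
    · calc |inner ℝ (e i) x| * |inner ℝ (e l) ξ| ≤ (5 * A * K ^ 2 * R) * Y := by
            gcongr
            · exact hlongx i hi
            · exact hξY l
        _ = _ := by ring
  -- The only product `⟪e i, x⟫ * ⟪e l, ξ⟫` that may be large has `i = l = j`; no minor contains it.
  have hdist := norm_mul_norm_sub_inner_smul_le e x ξ hξ (B := 10 * A * K ^ 2 * (R * Y))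
    (by positivity) (fun i l => by
      by_cases hil : i = l
      · rw [hil, sub_self, abs_zero]; positivity
      · refine (abs_sub _ _).trans ?_
        linarith [hprod i l hil, hprod l i (Ne.symm hil)])
  change ‖x - inner ℝ (‖ξ‖⁻¹ • ξ) x • (‖ξ‖⁻¹ • ξ)‖ ≤ _
  have h9 : ‖x - inner ℝ (‖ξ‖⁻¹ • ξ) x • (‖ξ‖⁻¹ • ξ)‖ ≤ n * (10 * A * K ^ 2 * (R * Y)) / ‖ξ‖ := by
    rw [le_div_iff₀ hξ0, mul_comm]
    exact hdist
  calc _ ≤ n * (10 * A * K ^ 2 * (R * Y)) / ‖ξ‖ := h9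
    _ = 20 * n * A * K ^ 2 * (R * Y) / (lam * ‖ξ‖) * (lam / 2) := by field_simp; ring
    _ ≤ _ := by gcongr

/-- Products of the side lengths of a cap: all sides, all but the short one, all but a long one. -/
theorem prod_side_bounds {k : ℕ} {r : Fin (k + 1) → ℝ} {j : Fin (k + 1)} {A R δ : ℝ} (hA : 1 ≤ A)
    (hR : 0 < R) (hδ : 0 < δ) (hlong : ∀ i, i ≠ j → A⁻¹ * R ≤ r i ∧ r i ≤ A * R)
    (hshort : A⁻¹ * δ ≤ r j ∧ r j ≤ A * δ) :
    A⁻¹ ^ (k + 1) * (R ^ k * δ) ≤ ∏ i, r i ∧ ∏ i, r i ≤ A ^ (k + 1) * (R ^ k * δ) ∧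
      ∏ i ∈ Finset.univ.erase j, r i ≤ A ^ k * R ^ k ∧
      ∀ l, l ≠ j → (∏ i ∈ Finset.univ.erase l, r i) * R ≤ A ^ k * R ^ k * δ := by
  classical
  have hA0 : 0 < A := by linarith
  have hpos : ∀ i, 0 ≤ r i := fun i => by
    by_cases h : i = j
    · rw [h]; exact le_trans (by positivity) hshort.1
    · exact le_trans (by positivity) (hlong i h).1
  have hcard : (Finset.univ.erase j).card = k := by simp
  have h1 : ∏ i ∈ Finset.univ.erase j, r i ≤ A ^ k * R ^ k := by
    calc _ ≤ ∏ i ∈ Finset.univ.erase j, A * R := Finset.prod_le_prod (fun i _ => hpos i)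
          fun i hi => (hlong i (Finset.ne_of_mem_erase hi)).2
      _ = _ := by rw [Finset.prod_const, hcard, mul_pow]
  have h2 : A⁻¹ ^ k * R ^ k ≤ ∏ i ∈ Finset.univ.erase j, r i := by
    calc A⁻¹ ^ k * R ^ k = ∏ i ∈ Finset.univ.erase j, A⁻¹ * R := by
          rw [Finset.prod_const, hcard, mul_pow]
      _ ≤ _ := Finset.prod_le_prod (fun i _ => by positivity)
          fun i hi => (hlong i (Finset.ne_of_mem_erase hi)).1
  have h3 := Finset.mul_prod_erase Finset.univ r (Finset.mem_univ j)
  refine ⟨?_, ?_, h1, fun l hl => ?_⟩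
  · rw [← h3]
    calc A⁻¹ ^ (k + 1) * (R ^ k * δ) = (A⁻¹ * δ) * (A⁻¹ ^ k * R ^ k) := by ring
      _ ≤ _ := mul_le_mul hshort.1 h2 (by positivity) (hpos j)
  · rw [← h3]
    calc _ ≤ (A * δ) * (A ^ k * R ^ k) :=
          mul_le_mul hshort.2 h1 (Finset.prod_nonneg fun i _ => hpos i) (by positivity)
      _ = _ := by ring
  · have hjl : j ∈ Finset.univ.erase l := Finset.mem_erase.mpr ⟨hl.symm, Finset.mem_univ j⟩
    have hcard2 : ((Finset.univ.erase l).erase j).card + 1 = k := by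
      rw [Finset.card_erase_of_mem hjl, Finset.card_erase_of_mem (Finset.mem_univ l),
        Finset.card_univ, Fintype.card_fin]
      have : 0 < (Finset.univ.erase l).card := Finset.card_pos.mpr ⟨j, hjl⟩
      rw [Finset.card_erase_of_mem (Finset.mem_univ l), Finset.card_univ, Fintype.card_fin] at this
      omega
    rw [← Finset.mul_prod_erase _ r hjl]
    calc r j * (∏ i ∈ (Finset.univ.erase l).erase j, r i) * R
        ≤ (A * δ) * (∏ i ∈ (Finset.univ.erase l).erase j, A * R) * R := by
          refine mul_le_mul_of_nonneg_right (mul_le_mul hshort.2 ?_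
            (Finset.prod_nonneg fun i _ => hpos i) (by positivity)) hR.le
          exact Finset.prod_le_prod (fun i _ => hpos i) fun i hi =>
            (hlong i (Finset.ne_of_mem_erase hi)).2
      _ = A ^ k * R ^ k * δ := by
          rw [Finset.prod_const]
          conv_rhs => rw [← hcard2]
          rw [mul_pow]
          ring

/-- The caps of a family of bounded overlap that lie in the part of an annulus in a double cone
are counted by comparing volumes. -/
theorem ncard_caps_in_doubleCone {k : ℕ} {A K : ℝ} {m : ℕ} (hA : 1 ≤ A) (hK : 1 ≤ K) {lam δ R τ : ℝ}
    (hlam : 1 ≤ lam) (hδ : 0 < δ) (hδ1 : δ ≤ 1) (hR : 0 < R) (hRdef : (lam * δ) ^ (1 / 2 : ℝ) = R)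
    (hτ : 0 ≤ τ) {f : EuclideanSpace ℝ (Fin (k + 1))} (hf : ‖f‖ = 1)
    {Ω : Set (Set (EuclideanSpace ℝ (Fin (k + 1))))}
    (hcap : ∀ ω ∈ Ω, IsCap (k + 1) A lam δ ω)
    (hann : ∀ ω ∈ Ω, ω ⊆ annulus (k + 1) lam (K * δ))
    (hcone : ∀ ω ∈ Ω, ω ⊆ doubleCone f τ) (hover : ∀ x, {ω ∈ Ω | x ∈ ω}.encard ≤ m) :
    Ω.Finite ∧ (Ω.ncard : ℝ) * R ^ k ≤
      m * A ^ (k + 1) * (2 ^ (k + 2) * K * (k + 1) * (2 * K) ^ k) * (τ * lam) ^ k := by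
  have hA0 : 0 < A := by linarith
  have hK0 : 0 < K := by linarith
  have hlam0 : 0 < lam := by linarith
  obtain ⟨hfin, hle⟩ := finite_and_ncard_mul_le_of_overlap MeasureTheory.volume
    (Ω := Ω) (U := doubleCone f τ ∩ annulus (k + 1) lam (K * δ)) (m := m)
    (v := A⁻¹ ^ (k + 1) * (R ^ k * δ))
    (w := 2 ^ (k + 1) * τ ^ k * ((k + 1) * (lam + K * δ) ^ k * (2 * (K * δ))))
    (by positivity) (by positivity)
    (fun ω hω => by
      obtain ⟨p, e, r, j, -, -, rfl⟩ := hcap ω hω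
      exact measurableSet_box p e r)
    (fun ω hω => Set.subset_inter (hcone ω hω) (hann ω hω))
    (fun ω hω => by
      obtain ⟨p, e, r, j, hlong, hshort, rfl⟩ := hcap ω hω
      rw [hRdef] at hlong
      rw [volume_box p e (fun i => by
        by_cases h : i = j
        · rw [h]; exact le_trans (by positivity) hshort.1
        · exact le_trans (by positivity) (hlong i h).1)]
      exact ENNReal.ofReal_le_ofReal (prod_side_bounds hA hR hδ hlong hshort).1)
    (volume_doubleCone_inter_annulus_le hf hτ hlam0.le (by positivity)) hover
  refine ⟨hfin, ?_⟩
  have h1 : lam + K * δ ≤ 2 * K * lam := by nlinarith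
  have h2 : (Ω.ncard : ℝ) * (A⁻¹ ^ (k + 1) * (R ^ k * δ)) ≤
      m * (2 ^ (k + 1) * τ ^ k * ((k + 1) * (2 * K * lam) ^ k * (2 * (K * δ)))) :=
    hle.trans (by gcongr)
  have h3 : (Ω.ncard : ℝ) * R ^ k = A ^ (k + 1) * δ⁻¹ *
      ((Ω.ncard : ℝ) * (A⁻¹ ^ (k + 1) * (R ^ k * δ))) := by
    rw [inv_pow]; field_simp
  rw [h3]
  calc _ ≤ A ^ (k + 1) * δ⁻¹ *
      (m * (2 ^ (k + 1) * τ ^ k * ((k + 1) * (2 * K * lam) ^ k * (2 * (K * δ))))) := by gcongr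
    _ = _ := by
      rw [mul_pow (2 * K) lam, mul_pow τ]
      field_simp
      ring

end CapGeometry

/-! ### Summation over the dual lattice -/

/-- In dimension `k + 1` each of the shells `‖a‖ = 1, …, M` contributes a bounded amount to the sum
of `‖a‖ ^ (-k)` over nonzero integral vectors. -/
theorem sum_inv_norm_pow_le (k M : ℕ) :
    ∑ a ∈ (Fintype.piFinset fun _ : Fin (k + 1) => Finset.Icc (-M : ℤ) M).erase 0, (‖a‖ ^ k)⁻¹ ≤
      2 * (k + 1) * 3 ^ k * M := by
  classical
  induction M with
  | zero =>
    refine le_of_eq ?_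
    rw [Finset.sum_eq_zero, Nat.cast_zero, mul_zero]
    intro a ha
    rw [Finset.mem_erase, Fintype.mem_piFinset] at ha
    refine (ha.1 (funext fun i => ?_)).elim
    simpa using ha.2 i
  | succ M ih =>
    set s : ℕ → Finset (Fin (k + 1) → ℤ) :=
      fun M => Fintype.piFinset fun _ : Fin (k + 1) => Finset.Icc (-M : ℤ) M
    have hsub : s M ⊆ s (M + 1) := by
      intro a ha
      simp only [s, Fintype.mem_piFinset, Finset.mem_Icc] at ha ⊢
      intro i
      have := ha i
      push_cast
      omega
    have hunion : (s (M + 1)).erase 0 ⊆ (s M).erase 0 ∪ (s (M + 1) \ s M) := by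
      intro a ha
      rw [Finset.mem_erase] at ha
      by_cases h : a ∈ s M
      · exact Finset.mem_union_left _ (Finset.mem_erase.mpr ⟨ha.1, h⟩)
      · exact Finset.mem_union_right _ (Finset.mem_sdiff.mpr ⟨ha.2, h⟩)
    have hcard : ((s (M + 1) \ s M).card : ℝ) ≤ 2 * (k + 1) * (3 * (M + 1)) ^ k := by
      have h1 : (s (M + 1) \ s M).card + (2 * M + 1) ^ (k + 1) = (2 * M + 3) ^ (k + 1) := by
        rw [Finset.card_sdiff_of_subset hsub]
        have h2 : (s M).card = (2 * M + 1) ^ (k + 1) := by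
          simp only [s, Fintype.card_piFinset, Int.card_Icc, Finset.prod_const, Finset.card_univ,
            Fintype.card_fin]
          congr 1
          omega
        have h3 : (s (M + 1)).card = (2 * M + 3) ^ (k + 1) := by
          simp only [s, Fintype.card_piFinset, Int.card_Icc, Finset.prod_const, Finset.card_univ,
            Fintype.card_fin]
          congr 1
          push_cast
          omega
        rw [h2, h3]
        exact Nat.sub_add_cancel (Nat.pow_le_pow_left (by omega) _)
      have h4 : ((s (M + 1) \ s M).card : ℝ) + (2 * M + 1) ^ (k + 1) = (2 * M + 3) ^ (k + 1) := by
        exact_mod_cast h1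
      have h5 := abs_pow_sub_pow_le (2 * (M : ℝ) + 3) (2 * M + 1) (k + 1)
      rw [abs_of_nonneg (by positivity : (0 : ℝ) ≤ 2 * M + 3),
        abs_of_nonneg (by positivity : (0 : ℝ) ≤ 2 * M + 1), max_eq_left (by linarith)] at h5
      have h6 : |2 * (M : ℝ) + 3 - (2 * M + 1)| = 2 := by
        rw [show 2 * (M : ℝ) + 3 - (2 * M + 1) = 2 by ring, abs_two]
      rw [h6, Nat.add_sub_cancel] at h5
      push_cast at h5
      have h7 : (2 * (M : ℝ) + 3) ^ k ≤ (3 * (M + 1)) ^ k := by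
        gcongr
        have : (0 : ℝ) ≤ M := by positivity
        linarith
      have h8 := le_abs_self ((2 * (M : ℝ) + 3) ^ (k + 1) - (2 * M + 1) ^ (k + 1))
      have h9 : 2 * ((k : ℝ) + 1) * (2 * (M : ℝ) + 3) ^ k ≤ 2 * (k + 1) * (3 * (M + 1)) ^ k := by
        gcongr
      linarith
    have hterm : ∀ a ∈ s (M + 1) \ s M, (‖a‖ ^ k)⁻¹ ≤ (((M : ℝ) + 1) ^ k)⁻¹ := by
      intro a ha
      rw [Finset.mem_sdiff] at ha
      have h1 : ¬ ∀ i, a i ∈ Finset.Icc (-M : ℤ) M := fun h => ha.2 (Fintype.mem_piFinset.mpr h)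
      push Not at h1
      obtain ⟨i, hi⟩ := h1
      have h2 : (M : ℤ) + 1 ≤ |a i| := by
        rw [Finset.mem_Icc, ← abs_le] at hi
        omega
      have h3 : (M : ℝ) + 1 ≤ ‖a‖ := by
        calc (M : ℝ) + 1 ≤ |(a i : ℝ)| := by exact_mod_cast h2
          _ = ‖a i‖ := by rw [Int.norm_eq_abs]
          _ ≤ ‖a‖ := norm_le_pi_norm a i
      gcongr
    calc ∑ a ∈ (s (M + 1)).erase 0, (‖a‖ ^ k)⁻¹
        ≤ ∑ a ∈ (s M).erase 0 ∪ (s (M + 1) \ s M), (‖a‖ ^ k)⁻¹ :=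
          Finset.sum_le_sum_of_subset_of_nonneg hunion fun _ _ _ => by positivity
      _ ≤ ∑ a ∈ (s M).erase 0, (‖a‖ ^ k)⁻¹ + ∑ a ∈ s (M + 1) \ s M, (‖a‖ ^ k)⁻¹ := by
          rw [← Finset.sum_union_inter]
          exact le_add_of_nonneg_right (Finset.sum_nonneg fun _ _ => by positivity)
      _ ≤ 2 * (k + 1) * 3 ^ k * M + (s (M + 1) \ s M).card * (((M : ℝ) + 1) ^ k)⁻¹ := by
          refine add_le_add ih ((Finset.sum_le_sum hterm).trans ?_)
          rw [Finset.sum_const, nsmul_eq_mul]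
      _ ≤ 2 * (k + 1) * 3 ^ k * M +
            (2 * (k + 1) * (3 * (M + 1)) ^ k) * (((M : ℝ) + 1) ^ k)⁻¹ := by gcongr
      _ = 2 * (k + 1) * 3 ^ k * (M + 1 : ℕ) := by
          rw [mul_pow]
          push_cast
          field_simp

/-- The caps of a cover to which a dual lattice vector `ξ` of length at most `Y₀ * X` is almost
normal are counted by summing `(X / ‖ξ‖) ^ k`, which bounds the number of caps in the cone about
`ξ`, over the dual lattice. -/
theorem exists_ncard_le_of_dual_vector {k : ℕ}
    (b : Basis (Fin (k + 1)) ℝ (EuclideanSpace ℝ (Fin (k + 1)))) {A K Y₀ : ℝ} (m : ℕ) (hA : 1 ≤ A)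
    (hK : 1 ≤ K) (hY₀ : 0 < Y₀) :
    ∃ C : ℝ, 0 < C ∧ ∀ lam δ R X : ℝ, 1 ≤ lam → 2 * K ≤ lam → 0 < δ → δ ≤ 1 → 0 < R →
      (lam * δ) ^ (1 / 2 : ℝ) = R → 0 < X → ∀ Ω : Set (Set (EuclideanSpace ℝ (Fin (k + 1)))),
      (∀ x, {ω ∈ Ω | x ∈ ω}.encard ≤ m) → (∀ ω ∈ Ω, ω ⊆ annulus (k + 1) lam (K * δ)) →
      (∀ ω ∈ Ω, ∃ (p : EuclideanSpace ℝ (Fin (k + 1)))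
        (e : OrthonormalBasis (Fin (k + 1)) ℝ (EuclideanSpace ℝ (Fin (k + 1))))
        (r : Fin (k + 1) → ℝ) (j : Fin (k + 1)),
        (∀ i, i ≠ j → A⁻¹ * R ≤ r i ∧ r i ≤ A * R) ∧ (A⁻¹ * δ ≤ r j ∧ r j ≤ A * δ) ∧
        ω = box p e r ∧ ∃ ξ : EuclideanSpace ℝ (Fin (k + 1)), ξ ≠ 0 ∧
          (∀ i, ∃ z : ℤ, inner ℝ ξ (b i) = z) ∧ (∀ i, |inner ℝ ξ (e i)| ≤ Y₀ * X) ∧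
          ∀ i, i ≠ j → |inner ℝ ξ (e i)| ≤ Y₀ * X * (R / lam)) →
      Ω.Finite ∧ (Ω.ncard : ℝ) ≤ C * X ^ (k + 1) := by
  classical
  have hA0 : 0 < A := by linarith
  have hK0 : 0 < K := by linarith
  set β := 1 + ∑ i, ‖b i‖ with hβ
  have hβ0 : 0 < β := by positivity
  have hβi : ∀ i, ‖b i‖ ≤ β := fun i => by
    have := Finset.single_le_sum (f := fun i => ‖b i‖) (fun _ _ => norm_nonneg _)
      (Finset.mem_univ i)
    rw [hβ]
    linarith
  set D := m * A ^ (k + 1) * (2 ^ (k + 2) * K * (k + 1) * (2 * K) ^ k) with hD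
  have hD0 : 0 ≤ D := by positivity
  set c := 20 * ((k + 1 : ℕ) : ℝ) * A * K ^ 2 * Y₀ with hc
  have hc0 : 0 < c := by positivity
  refine ⟨D * (c * β) ^ k * (2 * (k + 1) * 3 ^ k * (β * ((k + 1) * Y₀))) + 1, by positivity, ?_⟩
  intro lam δ R X hlam hlamK hδ hδ1 hR hRdef hX Ω hover hann hΩ
  have hlam0 : 0 < lam := by linarith
  have hR2 : R ^ 2 = lam * δ := by
    rw [← hRdef, ← Real.rpow_natCast, ← Real.rpow_mul (by positivity)]
    norm_num
  have hcap : ∀ ω ∈ Ω, IsCap (k + 1) A lam δ ω := fun ω hω => by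
    obtain ⟨p, e, r, j, h1, h2, h3, -⟩ := hΩ ω hω
    exact ⟨p, e, r, j, by rwa [hRdef], h2, h3⟩
  have hdual : ∀ ω ∈ Ω, ∃ ξ : EuclideanSpace ℝ (Fin (k + 1)), ξ ≠ 0 ∧
      (∃ a : Fin (k + 1) → ℤ, ∀ i, inner ℝ ξ (b i) = a i) ∧ ‖ξ‖ ≤ (k + 1) * Y₀ * X ∧
      ω ⊆ doubleCone (‖ξ‖⁻¹ • ξ) (c * (R * X) / (lam * ‖ξ‖)) := by
    intro ω hω
    obtain ⟨p, e, r, j, h1, h2, rfl, ξ, hξ0, hξb, hξY, hξR⟩ := hΩ ω hω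
    choose a ha using hξb
    refine ⟨ξ, hξ0, ⟨a, ha⟩, ?_, ?_⟩
    · calc ‖ξ‖ = ‖∑ i, inner ℝ (e i) ξ • e i‖ := by rw [e.sum_repr' ξ]
        _ ≤ ∑ i, ‖inner ℝ (e i) ξ • e i‖ := norm_sum_le _ _
        _ ≤ ∑ _i : Fin (k + 1), Y₀ * X := Finset.sum_le_sum fun i _ => by
            rw [norm_smul, e.norm_eq_one, mul_one, real_inner_comm]
            exact hξY i
        _ = (k + 1) * Y₀ * X := by simp; ring
    · have hrnn : ∀ i, 0 ≤ r i := fun i => by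
        by_cases h : i = j
        · rw [h]; exact le_trans (by positivity) h2.1
        · exact le_trans (by positivity) (h1 i h).1
      have := box_subset_doubleCone (Y := Y₀ * X) hA hK hlam hlamK hδ hδ1 hR hR2 hrnn h1
        (hann _ hω) hξ0 (by positivity) (fun i => by rw [real_inner_comm]; exact hξY i)
        (fun i hi => by rw [real_inner_comm]; exact hξR i hi)
      convert this using 2
      rw [hc]
      ring
  -- The caps are sorted by the integral coordinates `a` of their dual vectors, which determine `ξ`.
  choose! ξ hξ0 hξa hξn hξc using hdual
  choose! a ha using hξa
  set M := ⌊β * ((k + 1) * Y₀ * X)⌋₊ with hM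
  have hnorm : ∀ ω ∈ Ω, ‖a ω‖ ≤ β * ‖ξ ω‖ := by
    intro ω hω
    rw [pi_norm_le_iff_of_nonneg (by positivity)]
    intro i
    rw [Int.norm_eq_abs, ← ha ω hω i]
    calc _ ≤ ‖ξ ω‖ * ‖b i‖ := abs_real_inner_le_norm _ _
      _ ≤ ‖ξ ω‖ * β := by gcongr; exact hβi i
      _ = _ := mul_comm _ _
  have ha0 : ∀ ω ∈ Ω, a ω ≠ 0 := by
    intro ω hω h
    refine hξ0 ω hω (InnerProductSpace.ext_inner_right_basis b fun i => ?_)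
    rw [ha ω hω i, h, inner_zero_left]
    simp
  set I := (Fintype.piFinset fun _ : Fin (k + 1) => Finset.Icc (-M : ℤ) M).erase 0 with hI
  have haI : ∀ ω ∈ Ω, a ω ∈ I := by
    intro ω hω
    rw [hI, Finset.mem_erase, Fintype.mem_piFinset]
    refine ⟨ha0 ω hω, fun i => ?_⟩
    rw [Finset.mem_Icc, ← abs_le]
    have h1 : ((|a ω i|.toNat : ℕ) : ℝ) ≤ β * ((k + 1) * Y₀ * X) := by
      have h2 : ((|a ω i|.toNat : ℤ) : ℝ) = |(a ω i : ℝ)| := by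
        rw [Int.toNat_of_nonneg (abs_nonneg _), Int.cast_abs]
      rw [Int.cast_natCast] at h2
      rw [h2, ← Int.norm_eq_abs]
      calc _ ≤ ‖a ω‖ := norm_le_pi_norm _ i
        _ ≤ β * ‖ξ ω‖ := hnorm ω hω
        _ ≤ _ := by gcongr; exact hξn ω hω
    have h3 := Nat.le_floor h1
    have h4 := Int.self_le_toNat |a ω i|
    rw [← hM] at h3
    omega
  have hfib : ∀ v ∈ I, {ω ∈ Ω | a ω = v}.Finite ∧
      ({ω ∈ Ω | a ω = v}.ncard : ℝ) ≤ D * (c * β * X) ^ k * (‖v‖ ^ k)⁻¹ := by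
    intro v hv
    rcases Set.eq_empty_or_nonempty {ω ∈ Ω | a ω = v} with hemp | ⟨ω₀, hω₀, hav⟩
    · rw [hemp]
      refine ⟨Set.finite_empty, ?_⟩
      rw [Set.ncard_empty, Nat.cast_zero]
      positivity
    have hξeq : ∀ ω ∈ {ω ∈ Ω | a ω = v}, ξ ω = ξ ω₀ := by
      rintro ω ⟨hω, hω2⟩
      refine InnerProductSpace.ext_inner_right_basis b fun i => ?_
      rw [ha ω hω i, ha ω₀ hω₀ i, hω2, hav]
    have hpos : 0 < ‖ξ ω₀‖ := norm_pos_iff.mpr (hξ0 ω₀ hω₀)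
    obtain ⟨h1, h2⟩ := ncard_caps_in_doubleCone (Ω := {ω ∈ Ω | a ω = v}) (m := m) hA hK hlam hδ hδ1
      hR hRdef (τ := c * (R * X) / (lam * ‖ξ ω₀‖)) (by positivity)
      (f := ‖ξ ω₀‖⁻¹ • ξ ω₀) (by
        rw [norm_smul, norm_inv, norm_norm, inv_mul_cancel₀ hpos.ne'])
      (fun ω hω => hcap ω hω.1) (fun ω hω => hann ω hω.1)
      (fun ω hω => by
        have := hξc ω hω.1
        rwa [hξeq ω hω] at this)
      (fun x => le_trans (Set.encard_le_encard (t := {ω ∈ Ω | x ∈ ω})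
        fun ω hω => ⟨hω.1.1, hω.2⟩) (hover x))
    refine ⟨h1, ?_⟩
    have h3 : c * (R * X) / (lam * ‖ξ ω₀‖) * lam = R * (c * X / ‖ξ ω₀‖) := by field_simp
    rw [← hD, h3, mul_pow, mul_left_comm, mul_comm] at h2
    have h4 := le_of_mul_le_mul_left h2 (by positivity)
    have hv0 : 0 < ‖v‖ := norm_pos_iff.mpr (Finset.ne_of_mem_erase hv)
    have h5 : c * X / ‖ξ ω₀‖ ≤ c * β * X * ‖v‖⁻¹ := by
      have := hnorm ω₀ hω₀
      rw [hav] at this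
      rw [← div_eq_mul_inv, div_le_div_iff₀ hpos hv0]
      calc c * X * ‖v‖ ≤ c * X * (β * ‖ξ ω₀‖) := by gcongr
        _ = _ := by ring
    calc _ ≤ D * (c * X / ‖ξ ω₀‖) ^ k := h4
      _ ≤ D * (c * β * X * ‖v‖⁻¹) ^ k := by gcongr
      _ = _ := by rw [mul_pow _ ‖v‖⁻¹, inv_pow]; ring
  have hcover : Ω ⊆ ⋃ v ∈ I, {ω ∈ Ω | a ω = v} := by
    intro ω hω
    simp only [Set.mem_iUnion]
    exact ⟨a ω, haI ω hω, hω, rfl⟩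
  have hfinU : (⋃ v ∈ I, {ω ∈ Ω | a ω = v}).Finite :=
    Set.Finite.biUnion I.finite_toSet fun v hv => (hfib v hv).1
  refine ⟨hfinU.subset hcover, ?_⟩
  have hMle : (M : ℝ) ≤ β * ((k + 1) * Y₀ * X) := Nat.floor_le (by positivity)
  have hcard : (Ω.ncard : ℝ) ≤ ∑ v ∈ I, ({ω ∈ Ω | a ω = v}.ncard : ℝ) := by
    have h1 := Set.ncard_le_ncard hcover hfinU
    have h2 := Finset.set_ncard_biUnion_le I (fun v => {ω ∈ Ω | a ω = v})
    exact_mod_cast h1.trans h2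
  calc (Ω.ncard : ℝ) ≤ ∑ v ∈ I, ({ω ∈ Ω | a ω = v}.ncard : ℝ) := hcard
    _ ≤ ∑ v ∈ I, D * (c * β * X) ^ k * (‖v‖ ^ k)⁻¹ := Finset.sum_le_sum fun v hv => (hfib v hv).2
    _ = D * (c * β * X) ^ k * ∑ v ∈ I, (‖v‖ ^ k)⁻¹ := by rw [Finset.mul_sum]
    _ ≤ D * (c * β * X) ^ k * (2 * (k + 1) * 3 ^ k * M) := by
        gcongr
        exact sum_inv_norm_pow_le k M
    _ ≤ D * (c * β * X) ^ k * (2 * (k + 1) * 3 ^ k * (β * ((k + 1) * Y₀ * X))) := by gcongr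
    _ = D * (c * β) ^ k * (2 * (k + 1) * 3 ^ k * (β * ((k + 1) * Y₀))) * X ^ (k + 1) := by
        rw [mul_pow (c * β) X]; ring
    _ ≤ _ := by
        gcongr
        linarith

/-! ### Bad caps -/

/-- A basis of `2πL`, as a basis of the ambient space. -/
theorem exists_basis_span_eq {n : ℕ} (L : Submodule ℤ (EuclideanSpace ℝ (Fin n)))
    [DiscreteTopology L] [IsZLattice ℝ L] :
    ∃ b : Basis (Fin n) ℝ (EuclideanSpace ℝ (Fin n)),
      ∀ x, x ∈ (fun v => (2 * π) • v) '' (L : Set (EuclideanSpace ℝ (Fin n))) ↔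
        x ∈ Submodule.span ℤ (Set.range b) := by
  have : Module.Finite ℤ L := ZLattice.module_finite ℝ L
  have : Module.Free ℤ L := ZLattice.module_free ℝ L
  let b₀ := (Free.chooseBasis ℤ L).ofZLatticeBasis ℝ L
  have hcard : Fintype.card (Free.ChooseBasisIndex ℤ L) = n := by
    rw [← finrank_eq_card_basis b₀, finrank_euclideanSpace, Fintype.card_fin]
  let b₁ := b₀.reindex (Fintype.equivFinOfCardEq hcard)
  have hb₁ : Submodule.span ℤ (Set.range b₁) = L := by
    rw [Basis.range_reindex]
    exact (Free.chooseBasis ℤ L).ofZLatticeBasis_span ℝ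
  have h2π : (2 * π : ℝ) ≠ 0 := by positivity
  refine ⟨b₁.map (LinearEquiv.smulOfNeZero ℝ _ (2 * π) h2π), fun x => ?_⟩
  let f : EuclideanSpace ℝ (Fin n) →ₗ[ℤ] EuclideanSpace ℝ (Fin n) :=
    (LinearEquiv.smulOfNeZero ℝ _ (2 * π) h2π).toLinearMap.restrictScalars ℤ
  have hmap : Submodule.span ℤ (Set.range (b₁.map (LinearEquiv.smulOfNeZero ℝ _ (2 * π) h2π))) =
      L.map f := by
    conv_rhs => rw [← hb₁]
    rw [Submodule.map_span, ← Set.range_comp]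
    rfl
  rw [hmap, Submodule.mem_map]
  rfl

/-- The threshold for bad caps in terms of the long side `R = P ^ (1 / 2)` and the loss `X = P ^ η`. -/
theorem rpow_threshold_eq {k : ℕ} {P η : ℝ} (hP : 0 < P) :
    P ^ ((((k + 1 : ℕ) : ℝ) - 1) / 2 - η) = (P ^ (1 / 2 : ℝ)) ^ k / P ^ η := by
  rw [Real.rpow_sub hP, ← Real.rpow_natCast, ← Real.rpow_mul hP.le]
  congr 2
  push_cast
  ring

/-- The junk value `ncard = 0` of infinite sets does not meet the positive threshold. -/
theorem IsBad.finite_and_nonempty {n : ℕ} {L : Submodule ℤ (EuclideanSpace ℝ (Fin n))}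
    {b η lam δ : ℝ} {ω : Set (EuclideanSpace ℝ (Fin n))} (hb : 0 < b) (hlam : 0 < lam * δ)
    (h : IsBad L b η lam δ ω) : (latticePoints L ω).Finite ∧ (latticePoints L ω).Nonempty := by
  have h1 : 0 < (latticePoints L ω).ncard := by
    have h2 : (0 : ℝ) < (latticePoints L ω).ncard := lt_of_lt_of_le (by positivity) h
    exact_mod_cast h2
  exact ⟨Set.finite_of_ncard_pos h1, Set.nonempty_of_ncard_ne_zero h1.ne'⟩

theorem one_le_mul_of_rpow_lt {κ lam δ : ℝ} (hκ : 0 ≤ κ) (hlam : 1 ≤ lam)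
    (hδ : lam ^ (-1 + κ) < δ) : 0 < δ ∧ lam ^ κ ≤ lam * δ ∧ 1 ≤ lam * δ := by
  have hlam0 : 0 < lam := by linarith
  have h1 : lam ^ κ ≤ lam * δ := by
    have h2 : lam ^ κ = lam * lam ^ (-1 + κ) := by
      rw [Real.rpow_add hlam0, Real.rpow_neg_one, mul_inv_cancel_left₀ hlam0.ne']
    rw [h2]
    gcongr
  exact ⟨lt_trans (by positivity) hδ, h1, (Real.one_le_rpow hlam hκ).trans h1⟩

/-- A cover of an annulus of bounded radius has boundedly many caps. This disposes of small `lam`,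
where the estimates for caps in narrow cones do not apply. -/
theorem exists_ncard_cover_le (k : ℕ) {A K : ℝ} (m : ℕ) (hA : 1 ≤ A) (hK : 1 ≤ K) {lam₁ : ℝ}
    (hlam₁ : 1 ≤ lam₁) :
    ∃ C : ℝ, 0 < C ∧ ∀ lam δ : ℝ, 1 ≤ lam → lam ≤ lam₁ → 0 < δ → δ ≤ 1 → 1 ≤ lam * δ →
      ∀ Ω : Set (Set (EuclideanSpace ℝ (Fin (k + 1)))), IsCapCover (k + 1) A K m lam δ Ω →
        Ω.Finite ∧ (Ω.ncard : ℝ) ≤ C := by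
  have hA0 : 0 < A := by linarith
  have hK0 : 0 < K := by linarith
  have hlam₁0 : 0 < lam₁ := by linarith
  refine ⟨m * A ^ (k + 1) * (2 ^ (k + 2) * K * (k + 1) * (2 * K) ^ k) * lam₁ ^ k + 1,
    by positivity, ?_⟩
  intro lam δ hlam hlam2 hδ hδ1 hP Ω hΩ
  have hR1 : 1 ≤ (lam * δ) ^ (1 / 2 : ℝ) := Real.one_le_rpow hP (by norm_num)
  set f : EuclideanSpace ℝ (Fin (k + 1)) := EuclideanSpace.basisFun (Fin (k + 1)) ℝ 0
  have hf : ‖f‖ = 1 := (EuclideanSpace.basisFun (Fin (k + 1)) ℝ).norm_eq_one 0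
  obtain ⟨h1, h2⟩ := ncard_caps_in_doubleCone (τ := 1) hA hK hlam hδ hδ1 (by linarith) rfl
    zero_le_one hf hΩ.isCap hΩ.subset_annulus (fun ω _ x _ => by
      change ‖x - inner ℝ f x • f‖ ≤ 1 * ‖x‖
      refine abs_le_of_sq_le_sq' ?_ (by positivity) |>.2
      rw [norm_sub_sq_real, norm_smul, hf, inner_smul_right, real_inner_comm, Real.norm_eq_abs,
        mul_one, sq_abs]
      nlinarith [sq_nonneg (inner ℝ x f)]) hΩ.overlap
  refine ⟨h1, ?_⟩
  have h3 : (Ω.ncard : ℝ) ≤ Ω.ncard * ((lam * δ) ^ (1 / 2 : ℝ)) ^ k :=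
    le_mul_of_one_le_right (by positivity) (one_le_pow₀ hR1)
  refine (h3.trans h2).trans ?_
  rw [one_mul]
  have : lam ^ k ≤ lam₁ ^ k := by gcongr
  have h4 : 0 ≤ m * A ^ (k + 1) * (2 ^ (k + 2) * K * (k + 1) * (2 * K) ^ k) := by positivity
  nlinarith [mul_le_mul_of_nonneg_left this h4]

/-- Bad caps whose lattice points span a hyperplane are few, since each of them determines a dual
lattice vector of length `≲ X = (lam * δ) ^ η` that is almost normal to its long axes. -/
theorem exists_ncard_badCaps_le {k : ℕ} (L : Submodule ℤ (EuclideanSpace ℝ (Fin (k + 1))))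
    [DiscreteTopology L] [IsZLattice ℝ L] {A K b : ℝ} (m : ℕ) (hA : 1 ≤ A) (hK : 1 ≤ K)
    (hb : 0 < b) :
    ∃ C : ℝ, 0 < C ∧ ∀ η lam δ : ℝ, 0 < η → 1 ≤ lam → 0 < δ → δ ≤ 1 → 1 ≤ lam * δ →
      ∀ Ω : Set (Set (EuclideanSpace ℝ (Fin (k + 1)))), IsCapCover (k + 1) A K m lam δ Ω →
        (∀ ω ∈ badCaps L b η lam δ Ω, latticeDim L ω = k) →
        (badCaps L b η lam δ Ω).Finite ∧
          ((badCaps L b η lam δ Ω).ncard : ℝ) ≤ C * (lam * δ) ^ (η * (k + 1 : ℕ)) := by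
  have hA0 : 0 < A := by linarith
  obtain ⟨B, hB⟩ := exists_basis_span_eq L
  set c₀ := 3 ^ (k + 1) * |B.det (EuclideanSpace.basisFun (Fin (k + 1)) ℝ)| * (k + 1).factorial
    with hc₀def
  have hc₀ : 0 < c₀ := by
    have h1 : B.det (EuclideanSpace.basisFun (Fin (k + 1)) ℝ) ≠ 0 := by
      have := B.isUnit_det (EuclideanSpace.basisFun (Fin (k + 1)) ℝ).toBasis
      simpa using this.ne_zero
    have := abs_pos.mpr h1
    positivity
  obtain ⟨C₁, hC₁, h₁⟩ := exists_ncard_le_of_dual_vector B m hA hK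
    (Y₀ := c₀ * A ^ k / b) (by positivity)
  obtain ⟨C₂, hC₂, h₂⟩ := exists_ncard_cover_le k m hA hK (lam₁ := 2 * K) (by linarith)
  refine ⟨C₁ + C₂, by positivity, ?_⟩
  intro η lam δ hη hlam hδ hδ1 hP Ω hΩ hdim
  have hsub : badCaps L b η lam δ Ω ⊆ Ω := fun ω hω => hω.1
  have hP0 : 0 < lam * δ := by linarith
  have hlam0 : 0 < lam := by linarith
  have hpow : 1 ≤ (lam * δ) ^ (η * (k + 1 : ℕ)) := Real.one_le_rpow hP (by positivity)
  rcases le_total lam (2 * K) with hle | hge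
  · obtain ⟨hfin, hcard⟩ := h₂ lam δ hlam hle hδ hδ1 hP Ω hΩ
    refine ⟨hfin.subset hsub, ?_⟩
    have : ((badCaps L b η lam δ Ω).ncard : ℝ) ≤ Ω.ncard := by
      exact_mod_cast Set.ncard_le_ncard hsub hfin
    nlinarith
  set R := (lam * δ) ^ (1 / 2 : ℝ) with hR
  set X := (lam * δ) ^ η with hX
  have hR0 : 0 < R := by positivity
  have hX0 : 0 < X := by positivity
  have hR2 : R ^ 2 = lam * δ := by
    rw [hR, ← Real.rpow_natCast, ← Real.rpow_mul hP0.le]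
    norm_num
  have hRlam : R ≤ lam := by nlinarith
  obtain ⟨hfin, hcard⟩ := h₁ lam δ R X hlam hge hδ hδ1 hR0 rfl hX0 (badCaps L b η lam δ Ω)
    (fun x => (Set.encard_le_encard (t := {ω ∈ Ω | x ∈ ω}) fun ω hω => ⟨hω.1.1, hω.2⟩).trans
      (hΩ.overlap x))
    (fun ω hω => hΩ.subset_annulus ω hω.1) (fun ω hω => by
      have hbad := hω.2
      obtain ⟨hfin, x₀, hx₀⟩ := hbad.finite_and_nonempty hb hP0
      obtain ⟨p, e, r, j, hlong, hshort, rfl⟩ := hΩ.isCap ω hω.1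
      rw [← hR] at hlong
      have hd := hdim _ hω
      rw [IsBad, rpow_threshold_eq hP0, Set.ncard_eq_toFinset_card _ hfin, ← hR, ← hX] at hbad
      obtain ⟨ξ, hξ0, hξb, hξ⟩ := exists_dual_vector B hfin.toFinset
        (fun x hx => (hB x).mp ((Set.Finite.mem_toFinset _).mp hx).2)
        ((Set.Finite.mem_toFinset _).mpr hx₀) (by rw [Set.Finite.coe_toFinset]; exact hd)
        (fun x hx => ((Set.Finite.mem_toFinset _).mp hx).1)
      rw [← hc₀def] at hξ
      obtain ⟨-, -, hp1, hp2⟩ := prod_side_bounds hA hR0 hδ hlong hshort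
      have hbound : ∀ l, |inner ℝ ξ (e l)| ≤
          c₀ * (∏ i ∈ Finset.univ.erase l, r i) * X / (b * R ^ k) := by
        intro l
        have h3 : |inner ℝ ξ (e l)| * (b * (R ^ k / X)) ≤
            c₀ * ∏ i ∈ Finset.univ.erase l, r i :=
          (mul_le_mul_of_nonneg_left hbad (abs_nonneg _)).trans (hξ l)
        rw [le_div_iff₀ (by positivity)]
        calc |inner ℝ ξ (e l)| * (b * R ^ k) = |inner ℝ ξ (e l)| * (b * (R ^ k / X)) * X := by
              field_simp
          _ ≤ _ := by gcongr
      have hj : |inner ℝ ξ (e j)| ≤ c₀ * A ^ k / b * X := by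
        refine (hbound j).trans ?_
        calc _ ≤ c₀ * (A ^ k * R ^ k) * X / (b * R ^ k) := by gcongr
          _ = _ := by field_simp
      have hl : ∀ l, l ≠ j → |inner ℝ ξ (e l)| ≤ c₀ * A ^ k / b * X * (R / lam) := by
        intro l hlj
        refine (hbound l).trans ?_
        have h4 : ∏ i ∈ Finset.univ.erase l, r i ≤ A ^ k * R ^ k * δ / R :=
          (le_div_iff₀ hR0).mpr (hp2 l hlj)
        -- This is `R ^ 2 = lam * δ`: the aspect ratio of a cap is its angle seen from the origin.
        have h5 : δ / R = R / lam := by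
          rw [div_eq_div_iff hR0.ne' hlam0.ne', ← sq, hR2, mul_comm]
        calc _ ≤ c₀ * (A ^ k * R ^ k * δ / R) * X / (b * R ^ k) := by gcongr
          _ = c₀ * A ^ k / b * X * (δ / R) := by field_simp
          _ = _ := by rw [h5]
      refine ⟨p, e, r, j, hlong, hshort, rfl, ξ, hξ0, hξb, fun l => ?_, hl⟩
      by_cases hlj : l = j
      · rw [hlj]; exact hj
      · refine (hl l hlj).trans (mul_le_of_le_one_right (by positivity) ?_)
        exact (div_le_one hlam0).mpr hRlam)
  refine ⟨hfin, hcard.trans ?_⟩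
  have hXpow : X ^ (k + 1) = (lam * δ) ^ (η * (k + 1 : ℕ)) := by
    rw [hX, ← Real.rpow_natCast, ← Real.rpow_mul hP0.le]
  rw [hXpow]
  gcongr
  linarith

/-- A cap of small thickness with many lattice points does not contain a basis of the space, since
its volume is too small, and its lattice points do not lie in a subspace of codimension two. -/
theorem exists_latticeDim_eq {k : ℕ} (L : Submodule ℤ (EuclideanSpace ℝ (Fin (k + 1))))
    [DiscreteTopology L] [IsZLattice ℝ L] {A b κ σ : ℝ} (hA : 1 ≤ A) (hb : 0 < b) (hκ : 0 < κ)
    (hσ : 0 < σ) :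
    ∃ lam₀ : ℝ, 1 ≤ lam₀ ∧ ∀ η lam δ : ℝ, 0 < η → η ≤ σ / 2 → η ≤ 1 / 4 → lam₀ ≤ lam →
      lam ^ (-1 + κ) < δ → δ ≤ lam ^ (-σ) → ∀ ω, IsCap (k + 1) A lam δ ω →
        IsBad L b η lam δ ω → latticeDim L ω = k := by
  have hA0 : 0 < A := by linarith
  obtain ⟨B, hB⟩ := exists_basis_span_eq L
  obtain ⟨s, hs, hsep⟩ := exists_le_norm_of_mem_span B
  set c₁ := 3 ^ (k + 1) * |B.det (EuclideanSpace.basisFun (Fin (k + 1)) ℝ)| * (k + 1).factorial *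
    A ^ (k + 1) with hc₁
  set c₂ := (1 + 2 * ((k + 1) * A) / s) ^ (k - 1) with hc₂
  have hc₁0 : 0 ≤ c₁ := by positivity
  have hc₂0 : 0 ≤ c₂ := by positivity
  refine ⟨1 + (c₁ / b) ^ (2 / σ) + (c₂ / b) ^ (4 / κ), ?_, ?_⟩
  · have h1 : 0 ≤ (c₁ / b) ^ (2 / σ) := by positivity
    have h2 : 0 ≤ (c₂ / b) ^ (4 / κ) := by positivity
    linarith
  intro η lam δ hη hησ hη4 hlam₀ hδκ hδσ ω hcap hbad
  have hpow₁ : 0 ≤ (c₁ / b) ^ (2 / σ) := by positivity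
  have hpow₂ : 0 ≤ (c₂ / b) ^ (4 / κ) := by positivity
  have hlam : 1 ≤ lam := by linarith
  have hlam0 : 0 < lam := by linarith
  obtain ⟨hδ, hPκ, hP⟩ := one_le_mul_of_rpow_lt hκ.le hlam hδκ
  have hδ1 : δ ≤ 1 := hδσ.trans (Real.rpow_le_one_of_one_le_of_nonpos hlam (by linarith))
  have hP0 : 0 < lam * δ := by linarith
  -- The choice of the threshold for `lam`.
  have hbig₁ : c₁ / b < lam ^ (σ / 2) := by
    have h1 : (c₁ / b) ^ (2 / σ) < lam := by linarith
    have h2 := Real.rpow_lt_rpow (by positivity) h1 (by positivity : 0 < σ / 2)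
    rwa [← Real.rpow_mul (by positivity), div_mul_div_cancel₀ (by positivity), div_self (by norm_num),
      Real.rpow_one] at h2
  have hbig₂ : c₂ / b < lam ^ (κ / 4) := by
    have h1 : (c₂ / b) ^ (4 / κ) < lam := by linarith
    have h2 := Real.rpow_lt_rpow (by positivity) h1 (by positivity : 0 < κ / 4)
    rwa [← Real.rpow_mul (by positivity), div_mul_div_cancel₀ (by positivity), div_self (by norm_num),
      Real.rpow_one] at h2
  obtain ⟨hfin, x₀, hx₀⟩ := hbad.finite_and_nonempty hb hP0
  obtain ⟨p, e, r, j, hlong, hshort, rfl⟩ := hcap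
  rw [IsBad, rpow_threshold_eq hP0, Set.ncard_eq_toFinset_card _ hfin] at hbad
  set R := (lam * δ) ^ (1 / 2 : ℝ) with hR
  set X := (lam * δ) ^ η with hX
  have hR1 : 1 ≤ R := Real.one_le_rpow hP (by norm_num)
  have hR0 : 0 < R := by linarith
  have hX0 : 0 < X := by positivity
  set S := hfin.toFinset with hSdef
  have hSΛ : ∀ x ∈ S, x ∈ Submodule.span ℤ (Set.range B) :=
    fun x hx => (hB x).mp ((Set.Finite.mem_toFinset _).mp hx).2
  have hSbox : ∀ x ∈ S, x ∈ box p e r := fun x hx => ((Set.Finite.mem_toFinset _).mp hx).1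
  have hx₀S : x₀ ∈ S := (Set.Finite.mem_toFinset _).mpr hx₀
  have hdim : finrank ℝ (vectorSpan ℝ (S : Set (EuclideanSpace ℝ (Fin (k + 1))))) =
      latticeDim L (box p e r) := by
    rw [hSdef, Set.Finite.coe_toFinset]
    rfl
  have hdle : latticeDim L (box p e r) ≤ k + 1 := by
    rw [← hdim]
    exact (Submodule.finrank_le _).trans (by simp)
  have hlower : b * R ^ k ≤ S.card * X := by
    rw [← mul_div_assoc, div_le_iff₀ hX0] at hbad
    exact hbad
  -- With at most `c₁ * R ^ k * δ` points, badness gives `1 ≲ δ * X ≤ lam ^ (-σ / 2)`.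
  have hne₁ : latticeDim L (box p e r) ≠ k + 1 := by
    intro hd
    have h1 := card_le_of_finrank_eq B S hSΛ hx₀S (hdim.trans hd) hSbox
    have h2 : (S.card : ℝ) ≤ c₁ * (R ^ k * δ) := by
      refine h1.trans ?_
      rw [hc₁, mul_assoc (3 ^ (k + 1) * _ * _)]
      gcongr
      exact (prod_side_bounds hA hR0 hδ hlong hshort).2.1
    have h3 : R ^ k * b ≤ R ^ k * (c₁ * (δ * X)) := by
      calc R ^ k * b = b * R ^ k := mul_comm _ _
        _ ≤ S.card * X := hlower
        _ ≤ c₁ * (R ^ k * δ) * X := by gcongr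
        _ = _ := by ring
    have h4 := le_of_mul_le_mul_left h3 (by positivity)
    have h5 : δ * X ≤ lam ^ (-(σ / 2)) := by
      calc δ * X ≤ lam ^ (-σ) * lam ^ (σ / 2) := by
            have h6 : X ≤ lam ^ (σ / 2) := by
              calc X ≤ lam ^ η := by
                    rw [hX]
                    exact Real.rpow_le_rpow hP0.le (mul_le_of_le_one_right hlam0.le hδ1) hη.le
                _ ≤ lam ^ (σ / 2) := Real.rpow_le_rpow_of_exponent_le hlam hησ
            gcongr
        _ = lam ^ (-(σ / 2)) := by
            rw [← Real.rpow_add hlam0]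
            congr 1
            ring
    have h6 : b ≤ c₁ * (lam ^ (σ / 2))⁻¹ := by
      rw [← Real.rpow_neg hlam0.le]
      exact h4.trans (by gcongr)
    rw [← div_eq_mul_inv, le_div_iff₀ (by positivity)] at h6
    rw [div_lt_iff₀ hb] at hbig₁
    linarith
  -- With at most `c₂ * R ^ (k - 1)` points, badness gives `R ≲ X`, against `X ≤ R ^ (1 / 2)`.
  have hge : k ≤ latticeDim L (box p e r) := by
    by_contra! hd
    have hr : ∀ i, r i ≤ A * R := fun i => by
      by_cases h : i = j
      · rw [h]
        exact hshort.2.trans (by gcongr; linarith)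
      · exact (hlong i h).2
    have h1 := card_le_of_separated S hx₀S hs (ρ := (k + 1) * (A * R)) (by positivity)
      (fun x hx y hy hxy => hsep _ (Submodule.sub_mem _ (hSΛ x hx) (hSΛ y hy))
        (sub_ne_zero.mpr hxy)) (fun x hx => by
        calc ‖x - x₀‖ = ‖∑ i, inner ℝ (e i) (x - x₀) • e i‖ := by rw [e.sum_repr' (x - x₀)]
          _ ≤ ∑ i, ‖inner ℝ (e i) (x - x₀) • e i‖ := norm_sum_le _ _
          _ ≤ ∑ _i : Fin (k + 1), A * R := Finset.sum_le_sum fun i _ => by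
              rw [norm_smul, e.norm_eq_one, mul_one]
              exact (abs_inner_sub_le (hSbox x hx) (hSbox x₀ hx₀S) i).trans (hr i)
          _ = (k + 1) * (A * R) := by simp)
    rw [hdim] at h1
    have h2 : (S.card : ℝ) ≤ c₂ * R ^ (k - 1) := by
      calc (S.card : ℝ) ≤ _ := h1
        _ ≤ (1 + 2 * ((k + 1) * (A * R)) / s) ^ (k - 1) := by
            refine pow_le_pow_right₀ ?_ (by omega)
            have : 0 ≤ 2 * ((k + 1) * (A * R)) / s := by positivity
            linarith
        _ ≤ ((1 + 2 * ((k + 1) * A) / s) * R) ^ (k - 1) := by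
            gcongr
            have : 2 * ((k + 1) * (A * R)) / s = 2 * ((k + 1) * A) / s * R := by ring
            rw [this, add_mul, one_mul]
            linarith
        _ = _ := by rw [mul_pow]
    have h3 : R ^ (k - 1) * (b * R) ≤ R ^ (k - 1) * (c₂ * X) := by
      calc R ^ (k - 1) * (b * R) = b * R ^ k := by
            conv_rhs => rw [show k = k - 1 + 1 by omega, pow_succ]
            ring
        _ ≤ S.card * X := hlower
        _ ≤ c₂ * R ^ (k - 1) * X := by gcongr
        _ = _ := by ring
    have h4 := le_of_mul_le_mul_left h3 (by positivity)
    set Q := (lam * δ) ^ (1 / 4 : ℝ) with hQ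
    have hQ0 : 0 < Q := by positivity
    have hXQ : X ≤ Q := Real.rpow_le_rpow_of_exponent_le hP hη4
    have hRQ : R = Q * Q := by
      rw [hR, hQ, ← Real.rpow_add hP0]
      norm_num
    have h5 : (b * Q) * Q ≤ c₂ * Q := by
      calc (b * Q) * Q = b * R := by rw [hRQ]; ring
        _ ≤ c₂ * X := h4
        _ ≤ _ := by gcongr
    have h6 := le_of_mul_le_mul_right h5 hQ0
    have h7 : lam ^ (κ / 4) ≤ Q := by
      have := Real.rpow_le_rpow (by positivity) hPκ (by norm_num : (0 : ℝ) ≤ 1 / 4)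
      rwa [← Real.rpow_mul hlam0.le, mul_one_div] at this
    rw [div_lt_iff₀ hb] at hbig₂
    nlinarith
  omega

end TorusCaps

theorem theorem3p4 (n : ℕ) (hn : 2 ≤ n)
    (L : Submodule ℤ (EuclideanSpace ℝ (Fin n))) [DiscreteTopology L] [IsZLattice ℝ L]
    (κ : ℝ) (hκ : 0 < κ) (hκ1 : κ ≤ 1) :
    -- For small `η` every bad cap has dimension `n - 1`, and the bad caps of a cover are few.
    (∀ σ : ℝ, 0 < σ → ∃ η₀ : ℝ, 0 < η₀ ∧
      ∀ (A K : ℝ) (m : ℕ) (b : ℝ), 1 ≤ A → 1 ≤ K → 0 < b →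
      ∃ lam₀ C : ℝ, 1 ≤ lam₀ ∧ 0 < C ∧
      ∀ η : ℝ, 0 < η → η < η₀ →
      ∀ lam δ : ℝ, 1 ≤ lam → lam ^ (-1 + κ) < δ → δ ≤ lam ^ (-σ) →
        (lam₀ ≤ lam → ∀ ω : Set (EuclideanSpace ℝ (Fin n)),
          TorusCaps.IsCap n A lam δ ω → TorusCaps.IsBad L b η lam δ ω →
          TorusCaps.latticeDim L ω = n - 1) ∧
        (∀ Ω : Set (Set (EuclideanSpace ℝ (Fin n))),
          TorusCaps.IsCapCover n A K m lam δ Ω →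
          (TorusCaps.badCaps L b η lam δ Ω).Finite ∧
          ((TorusCaps.badCaps L b η lam δ Ω).ncard : ℝ) ≤ C * (lam * δ) ^ (η * n))) ∧
    -- In the whole range of windows, the count holds for every `η` such that all bad caps of the
    -- cover have dimension `n - 1`.
    (∀ (A K : ℝ) (m : ℕ) (b : ℝ), 1 ≤ A → 1 ≤ K → 0 < b →
      ∃ C : ℝ, 0 < C ∧
      ∀ η : ℝ, 0 < η →
      ∀ lam δ : ℝ, 1 ≤ lam → lam ^ (-1 + κ) < δ → δ ≤ 1 →
      ∀ Ω : Set (Set (EuclideanSpace ℝ (Fin n))),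
        TorusCaps.IsCapCover n A K m lam δ Ω →
        (∀ ω ∈ TorusCaps.badCaps L b η lam δ Ω, TorusCaps.latticeDim L ω = n - 1) →
        (TorusCaps.badCaps L b η lam δ Ω).Finite ∧
        ((TorusCaps.badCaps L b η lam δ Ω).ncard : ℝ) ≤ C * (lam * δ) ^ (η * n)) := by
  obtain ⟨k, rfl⟩ : ∃ k, n = k + 1 := ⟨n - 1, by omega⟩
  simp only [Nat.add_sub_cancel]
  refine ⟨fun σ hσ => ?_, fun A K m b hA hK hb => ?_⟩
  · refine ⟨min (σ / 2) (1 / 4), by positivity, fun A K m b hA hK hb => ?_⟩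
    obtain ⟨lam₀, hlam₀, hdim⟩ := TorusCaps.exists_latticeDim_eq L hA hb hκ hσ
    obtain ⟨C₁, hC₁, h₁⟩ := TorusCaps.exists_ncard_badCaps_le L m hA hK hb
    obtain ⟨C₂, hC₂, h₂⟩ := TorusCaps.exists_ncard_cover_le k m hA hK hlam₀
    refine ⟨lam₀, C₁ + C₂, hlam₀, by positivity, fun η hη hη₀ lam δ hlam hδκ hδσ => ?_⟩
    obtain ⟨hη1, hη2⟩ := lt_min_iff.mp hη₀
    obtain ⟨hδ, -, hP⟩ := TorusCaps.one_le_mul_of_rpow_lt hκ.le hlam hδκ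
    have hδ1 : δ ≤ 1 := hδσ.trans (Real.rpow_le_one_of_one_le_of_nonpos hlam (by linarith))
    have hpow : 1 ≤ (lam * δ) ^ (η * (k + 1 : ℕ)) := Real.one_le_rpow hP (by positivity)
    have hdim' := fun h : lam₀ ≤ lam => hdim η lam δ hη hη1.le hη2.le h hδκ hδσ
    refine ⟨hdim', fun Ω hΩ => ?_⟩
    rcases le_total lam lam₀ with hle | hge
    · obtain ⟨hfin, hcard⟩ := h₂ lam δ hlam hle hδ hδ1 hP Ω hΩ
      have hsub : TorusCaps.badCaps L b η lam δ Ω ⊆ Ω := fun ω hω => hω.1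
      refine ⟨hfin.subset hsub, ?_⟩
      have : ((TorusCaps.badCaps L b η lam δ Ω).ncard : ℝ) ≤ Ω.ncard := by
        exact_mod_cast Set.ncard_le_ncard hsub hfin
      nlinarith
    · obtain ⟨hfin, hcard⟩ := h₁ η lam δ hη hlam hδ hδ1 hP Ω hΩ
        fun ω hω => hdim' hge ω (hΩ.isCap ω hω.1) hω.2
      refine ⟨hfin, hcard.trans ?_⟩
      gcongr
      linarith
  · obtain ⟨C, hC, h⟩ := TorusCaps.exists_ncard_badCaps_le L m hA hK hb
    refine ⟨C, hC, fun η hη lam δ hlam hδκ hδ1 Ω hΩ hdim => ?_⟩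
    obtain ⟨hδ, -, hP⟩ := TorusCaps.one_le_mul_of_rpow_lt hκ.le hlam hδκ
    exact h η lam δ hη hlam hδ hδ1 hP Ω hΩ hdim
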